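/- For a positive integer $n$, let $\mathrm{ex}(n,C_4)$ denote the maximum number of edges of a simple graph on $n$ vertices that contains no cycle of length $4$ as a (not necessarily induced) subgraph. For every prime power $q>13$, $$\mathrm{ex}(q^2+q+1,\,C_4)=\tfrac12\,q(q+1)^2 .$$ Moreover, this value is attained by every Singer sum graph. Precisely, let $\mathbb F_q$ be a field with $q$ elements, $\mathbb F_{q^3}$ its extension of degree $3$, $\theta$ a generator of the multiplicative group $\mathbb F_{q^3}^*$, and let $$\mathcal B=\{\,b\in\mathbb Z/(q^3-1)\mathbb Z:\ \theta^b=\theta+a\ \text{for some } a\in\mathbb F_q\,\},\qquad \mathcal G_0=\bigl(\mathcal B \bmod (q^2+q+1)\bigr)\cup\{0\}\subset \mathbb Z/(q^2+q+1)\mathbb Z .$$ Then the graph with vertex set $\mathbb Z/(q^2+q+1)\mathbb Z$, in which two distinct vertices $x,y$ are adjacent if and only if $x+y\in\mathcal G_0$, contains no cycle of length $4$ and has exactly $\tfrac12 q(q+1)^2$ edges. -/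

import Mathlib

/-- The sum graph of a subset `A` of an additive abelian group `X`: the vertices are the elements
of `X`, and distinct `x`, `y` are adjacent exactly when `x + y ∈ A`. -/
def sumGraph {X : Type*} [AddCommGroup X] (A : Set X) : SimpleGraph X where
  Adj x y := x ≠ y ∧ x + y ∈ A
  symm := ⟨fun x y h => ⟨h.1.symm, by rw [add_comm]; exact h.2⟩⟩
  loopless := ⟨fun _ h => h.1 rfl⟩

/-- The Bose-Chowla set `log_θ (θ + F)` in `ℤ/(q^h - 1)ℤ`, where `F` is the field with `q` elements,
`K` its extension of degree `h`, and `θ` a generator of `Kˣ`. -/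
def boseChowlaSet (q h : ℕ) (F : Type*) {K : Type*} [Field F] [Field K] [Algebra F K]
    (θ : Kˣ) : Set (ZMod (q ^ h - 1)) :=
  {b | ∃ a : F, (θ : K) ^ b.val = (θ : K) + algebraMap F K a}

/-- The Singer set in `ℤ/(q² + q + 1)ℤ`: the reduction modulo `q² + q + 1` (a divisor of `q³ - 1`)
of the Bose-Chowla set in `ℤ/(q³ - 1)ℤ`, together with `0`. -/
def singerSet (q : ℕ) (F : Type*) {K : Type*} [Field F] [Field K] [Algebra F K]
    (θ : Kˣ) : Set (ZMod (q ^ 2 + q + 1)) :=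
  (fun b : ZMod (q ^ 3 - 1) => (b.val : ZMod (q ^ 2 + q + 1))) '' boseChowlaSet q 3 F θ ∪ {0}

/-! Upper bound. Suppose a quadrilateral-free graph on q² + q + 1 vertices has more than q(q+1)²/2
edges, and take it edge-maximal. Counting pairs gives maximum degree at most q + 1 (`degree_le`), so
the defects ε(v) = q + 1 - d(v) sum to at most q - 1. In particular the set S of defective vertices
has at most q - 1 elements.

The core is `exists_common_neighbor`: two vertices without defect have a common neighbour. If y, y'
had none, double counting (`card_far`, `card_inter_far_add`) would force |S| = q - 1 with all
defects equal to one. It would also produce two defective neighbours of y, each with many defective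
neighbours, and S is too small to contain all of these.

Hence the neighbourhoods of the non-defective vertices are lines of size q + 1, any two meeting in
exactly one point, with |S| < q lines missing from a projective plane. Such a family can be
completed (`newLines_cover`). The neighbourhood of a defective vertex s lies in one missing line,
and edge-maximality makes that line N(s) ∪ {s}. The graph is then that of a polarity whose absolute
points are the vertices of S. No absolute points is excluded by the friendship theorem; between 1
and q - 1 of them is excluded by parity and counting (`false_of_maximal`).

Lower bound. Modulo q² + q + 1, the exponent of a power of θ records that power up to a factor in F.
Unique factorisation of monic polynomials of degree at most 2 therefore makes the Singer set a Sidon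
set with q + 1 elements. A sum graph of a Sidon set has no quadrilateral, and its edges are counted
directly. -/

open Finset

/-! ### Quadrilateral-free graphs and their maximum degree -/

/-- Any two distinct vertices have at most one common neighbour. -/
def SimpleGraph.QuadFree {V : Type*} (G : SimpleGraph V) : Prop :=
  ∀ ⦃a b c d : V⦄, a ≠ b → G.Adj a c → G.Adj b c → G.Adj a d → G.Adj b d → c = d

theorem SimpleGraph.cycleGraph_four_free_iff {V : Type*} (G : SimpleGraph V) :
    (SimpleGraph.cycleGraph 4).Free G ↔ G.QuadFree := by
  constructor
  · intro h a b c d hab hac hbc had hbd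
    by_contra hcd
    refine h ⟨⟨⟨![a, c, b, d], ?_⟩, ?_⟩⟩
    · intro i j hij
      fin_cases i <;> fin_cases j <;>
        first
        | exact absurd hij (by decide)
        | exact hac | exact hbc | exact had | exact hbd
        | exact hac.symm | exact hbc.symm | exact had.symm | exact hbd.symm
    · have h1 := hac.ne
      have h2 := hbc.ne
      have h3 := had.ne
      have h4 := hbd.ne
      intro i j hij
      fin_cases i <;> fin_cases j <;> simp_all
  · rintro h ⟨f⟩
    have hf := f.injective
    have h1 : ∀ i j : Fin 4, (SimpleGraph.cycleGraph 4).Adj i j → G.Adj (f i) (f j) :=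
      fun i j hij => f.toHom.map_adj hij
    have h2 : f 1 = f 3 := h (a := f 0) (b := f 2) (fun e => absurd (hf e) (by decide))
      (h1 _ _ (by decide)) (h1 _ _ (by decide)) (h1 _ _ (by decide)) (h1 _ _ (by decide))
    exact absurd (hf h2) (by decide)

section
variable {V : Type*} [Fintype V] [DecidableEq V] {G : SimpleGraph V} [DecidableRel G.Adj]

/-- An ordered pair of distinct vertices outside N(x) lies in at most one N(z), so the sets of pairs
counted on the left are disjoint. -/
theorem SimpleGraph.QuadFree.sum_offDiag_le (h : G.QuadFree) (x : V) :
    ∑ z ∈ univ.erase x, (#(G.neighborFinset z \ G.neighborFinset x) *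
        #(G.neighborFinset z \ G.neighborFinset x) - #(G.neighborFinset z \ G.neighborFinset x)) ≤
      (Fintype.card V - G.degree x) * (Fintype.card V - G.degree x)
        - (Fintype.card V - G.degree x) := by
  have hc : Fintype.card V - G.degree x = #(univ \ G.neighborFinset x) := by
    rw [card_sdiff_of_subset (subset_univ _), card_univ, G.card_neighborFinset_eq_degree]
  rw [hc, ← offDiag_card]
  simp_rw [← offDiag_card]
  rw [← card_biUnion]
  · apply card_le_card
    intro p hp
    simp only [mem_biUnion, mem_offDiag, mem_sdiff, mem_univ, true_and] at hp ⊢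
    obtain ⟨z, -, h1, h2, h3⟩ := hp
    exact ⟨h1.2, h2.2, h3⟩
  · intro z _ w _ hzw
    rw [Function.onFun, Finset.disjoint_left]
    rintro ⟨a, b⟩ h1 h2
    simp only [mem_offDiag, mem_sdiff, SimpleGraph.mem_neighborFinset] at h1 h2
    exact h1.2.2 (h hzw h1.1.1 h2.1.1 h1.2.1.1 h2.2.1.1)

theorem SimpleGraph.QuadFree.card_inter_neighborFinset_le (h : G.QuadFree) {x z : V} (hxz : x ≠ z) :
    #(G.neighborFinset x ∩ G.neighborFinset z) ≤ 1 := by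
  rw [card_le_one]
  intro a ha b hb
  simp only [mem_inter, SimpleGraph.mem_neighborFinset] at ha hb
  exact h hxz ha.1 ha.2 hb.1 hb.2

/-- Each N(z) with z ≠ x loses at most one vertex to N(x). If d(x) ≥ q + 2, too few pairs are left
outside N(x) to accommodate the pairs inside all these sets. -/
theorem SimpleGraph.QuadFree.degree_le (h : G.QuadFree) {q : ℕ} (hq : 2 ≤ q)
    (hV : Fintype.card V = q ^ 2 + q + 1) (he : q * (q + 1) ^ 2 + 2 ≤ ∑ v, G.degree v) (x : V) :
    G.degree x ≤ q + 1 := by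
  by_contra hx
  push Not at hx
  have hs := h.sum_offDiag_le x
  have hlt : G.degree x < Fintype.card V := G.degree_lt_card_verts x
  have hk : ∀ z ∈ univ.erase x, (2 * (q : ℤ) - 2) * (G.degree z - 1) - q * (q - 1) ≤
      ((#(G.neighborFinset z \ G.neighborFinset x) *
        #(G.neighborFinset z \ G.neighborFinset x) - #(G.neighborFinset z \ G.neighborFinset x) : ℕ) : ℤ) := by
    intro z hz
    have hzx : z ≠ x := (mem_erase.mp hz).1
    have h1 := h.card_inter_neighborFinset_le hzx
    have h2 := card_sdiff_add_card_inter (G.neighborFinset z) (G.neighborFinset x)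
    rw [G.card_neighborFinset_eq_degree] at h2
    set k := #(G.neighborFinset z \ G.neighborFinset x)
    rw [Nat.cast_sub (Nat.le_mul_self k)]
    push_cast
    have h3 : (G.degree z : ℤ) - 1 ≤ k := by omega
    -- Integrality of k gives k(k-1) ≥ (2q-2)k - q(q-1), with equality at k = q - 1 and k = q; this
    -- linear bound can be summed over z.
    have h4 : (0 : ℤ) ≤ (k - q) * (k - q + 1) := by
      rcases le_or_gt (q : ℤ) k with h | h
      · exact mul_nonneg (by omega) (by omega)
      · exact mul_nonneg_of_nonpos_of_nonpos (by omega) (by omega)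
    have h5 : (0 : ℤ) ≤ (2 * q - 2) * (k - (G.degree z - 1)) := mul_nonneg (by omega) (by omega)
    nlinarith
  have hs' := sum_le_sum hk
  rw [sum_sub_distrib, ← mul_sum, sum_sub_distrib, sum_const, sum_const,
    card_erase_of_mem (mem_univ x), card_univ, hV] at hs'
  have hd : ∑ z ∈ univ.erase x, (G.degree z : ℤ) = (∑ z, G.degree z : ℕ) - G.degree x := by
    rw [← add_sum_erase _ _ (mem_univ x)]; push_cast; ring
  rw [hd, ← Nat.cast_sum] at hs'
  have h6 := hs'.trans (Nat.cast_le.mpr hs)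
  rw [Nat.cast_sub (Nat.le_mul_self _), Nat.cast_mul, Nat.cast_sub hlt.le, hV] at h6
  rw [hV] at hlt
  simp only [nsmul_eq_mul, add_tsub_cancel_right] at h6
  generalize ∑ v, G.degree v = E at h6 he
  generalize G.degree x = T at h6 hlt hx
  push_cast at h6
  obtain ⟨t, ht⟩ : ∃ t, T = q + 2 + t := ⟨T - (q + 2), by omega⟩
  have he' : (q : ℤ) * (q + 1) ^ 2 + 2 ≤ E := by exact_mod_cast he
  have hE : 0 ≤ (2 * (q : ℤ) - 2) * (E - (q * (q + 1) ^ 2 + 2)) :=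
    mul_nonneg (by omega) (by omega)
  have hT : (T : ℤ) = q + 2 + t := by exact_mod_cast ht
  rw [hT] at h6
  have ht2 : (t : ℤ) + 1 ≤ q ^ 2 - 1 := by
    have : (T : ℤ) < q ^ 2 + q + 1 := by exact_mod_cast hlt
    omega
  have hq' : (2 : ℤ) ≤ q := by exact_mod_cast hq
  have h7 : 0 ≤ (t : ℤ) * (q ^ 2 - 1 - (t + 1)) := mul_nonneg (by positivity) (by omega)
  have h8 : 0 ≤ (t : ℤ) * (q * (q - 2)) := mul_nonneg (by positivity) (mul_nonneg (by positivity) (by omega))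
  nlinarith

/-! ### Defects and pairs without a common neighbour -/

/-- A quadrilateral-free graph on `q² + q + 1` vertices with all degrees at most `q + 1`, where
`ε v` is the defect of the degree of `v` and the total defect is less than `q`. -/
structure SimpleGraph.IsNearRegular (G : SimpleGraph V) [DecidableRel G.Adj] (q : ℕ) (ε : V → ℕ) :
    Prop where
  quadFree : G.QuadFree
  degree_add (v : V) : G.degree v + ε v = q + 1
  card_eq : Fintype.card V = q ^ 2 + q + 1
  sum_lt : ∑ v, ε v < q

variable (G) in
/-- The vertices other than `s` that have no common neighbour with `s`. -/
def SimpleGraph.far (s : V) : Finset V := {w | w ≠ s ∧ ∀ u, G.Adj s u → ¬ G.Adj w u}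

theorem SimpleGraph.mem_far {s w : V} : w ∈ G.far s ↔ w ≠ s ∧ ∀ u, G.Adj s u → ¬ G.Adj w u := by
  simp [SimpleGraph.far]

theorem SimpleGraph.mem_far_comm {s w : V} : w ∈ G.far s ↔ s ∈ G.far w := by
  simp only [SimpleGraph.mem_far]
  exact ⟨fun h => ⟨h.1.symm, fun u h1 h2 => h.2 u h2 h1⟩,
    fun h => ⟨h.1.symm, fun u h1 h2 => h.2 u h2 h1⟩⟩

namespace SimpleGraph.IsNearRegular
variable {q : ℕ} {ε : V → ℕ}

/-- The sets N(v) \ {u}, for v adjacent to u, are disjoint; together with u they leave exactly `far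
u`. With no defects they would have q(q+1) elements in all. -/
theorem card_far (h : G.IsNearRegular q ε) (u : V) :
    #(G.far u) = q * ε u + ∑ v ∈ G.neighborFinset u, ε v := by
  have h1 : (univ : Finset V) = insert u (G.far u ∪
      (G.neighborFinset u).biUnion fun v => (G.neighborFinset v).erase u) := by
    ext w
    simp only [mem_univ, mem_insert, mem_union, mem_far, mem_biUnion, mem_erase,
      mem_neighborFinset, true_iff]
    by_cases hw : w = u
    · exact Or.inl hw
    · refine Or.inr ?_
      by_cases hc : ∃ v, G.Adj u v ∧ G.Adj v w
      · obtain ⟨v, h1, h2⟩ := hc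
        exact Or.inr ⟨v, h1, hw, h2⟩
      · exact Or.inl ⟨hw, fun v h1 h2 => hc ⟨v, h1, h2.symm⟩⟩
  have h2 : #((G.neighborFinset u).biUnion fun v => (G.neighborFinset v).erase u) =
      ∑ v ∈ G.neighborFinset u, (G.degree v - 1) := by
    rw [card_biUnion]
    · refine sum_congr rfl fun v hv => ?_
      rw [card_erase_of_mem (by simpa [adj_comm] using hv), card_neighborFinset_eq_degree]
    · intro v hv w hw hvw
      rw [Function.onFun, Finset.disjoint_left]
      intro a ha hb
      rw [mem_coe] at hv hw
      simp only [mem_erase, mem_neighborFinset] at ha hb hv hw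
      exact hvw (h.quadFree ha.1 ha.2.symm hv hb.2.symm hw)
  have h3 := congrArg card h1
  rw [card_univ, h.card_eq, card_insert_of_notMem, card_union_of_disjoint, h2] at h3
  · have h4 : ∑ v ∈ G.neighborFinset u, (G.degree v - 1) + ∑ v ∈ G.neighborFinset u, ε v =
        G.degree u * q := by
      rw [← sum_add_distrib, sum_congr rfl (g := fun _ => q), sum_const, smul_eq_mul,
        card_neighborFinset_eq_degree]
      intro v hv
      have : 0 < G.degree v := (G.degree_pos_iff_exists_adj v).2 ⟨u, by simpa [adj_comm] using hv⟩
      have := h.degree_add v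
      omega
    have h5 := h.degree_add u
    have h6 : G.degree u * q + ε u * q = q ^ 2 + q := by rw [← add_mul, h5]; ring
    nlinarith
  · rw [Finset.disjoint_left]
    intro w hw hw'
    simp only [mem_far, mem_biUnion, mem_erase, mem_neighborFinset] at hw hw'
    obtain ⟨v, h1, _, h2⟩ := hw'
    exact hw.2 v h1 h2.symm
  · simp [mem_far]

/-- Double counting of the adjacent pairs in N(p) × N(s): a vertex of N(p) has exactly one neighbour
in N(s), or none if it is far from s. Non-adjacency of p and s keeps s itself out of N(p). -/
theorem card_inter_far_add (h : G.IsNearRegular q ε) {p s : V} (hps : ¬ G.Adj p s) :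
    #(G.neighborFinset p ∩ G.far s) + ε p = ε s + #(G.far p ∩ G.neighborFinset s) := by
  have key : ∀ a b : V, ¬ G.Adj a b →
      ∑ x ∈ G.neighborFinset a, #((G.neighborFinset b).bipartiteAbove G.Adj x) +
        #(G.neighborFinset a ∩ G.far b) = G.degree a := by
    intro a b hab
    rw [← card_neighborFinset_eq_degree, ← filter_mem_eq_inter, card_filter, ← sum_add_distrib,
      card_eq_sum_ones]
    refine sum_congr rfl fun x hx => ?_
    have hxb : x ≠ b := by rintro rfl; exact hab (by simpa using hx)
    split_ifs with hf
    · simp only [Nat.add_eq_right, card_eq_zero, bipartiteAbove, filter_eq_empty_iff]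
      intro u hu
      exact (mem_far.1 hf).2 u (by simpa using hu)
    · simp only [mem_far, not_and, not_forall, not_not] at hf
      obtain ⟨u, h1, h2⟩ := hf hxb
      rw [add_zero, card_eq_one]
      refine ⟨u, ?_⟩
      ext w
      simp only [bipartiteAbove, mem_filter, mem_neighborFinset, mem_singleton]
      exact ⟨fun hw => h.quadFree hxb hw.2 hw.1 h2 h1, fun hw => hw ▸ ⟨h1, h2⟩⟩
  have h1 := key p s hps
  have h2 := key s p (fun e => hps e.symm)
  have h3 := sum_card_bipartiteAbove_eq_sum_card_bipartiteBelow (s := G.neighborFinset p)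
    (t := G.neighborFinset s) G.Adj
  have h4 : ∀ x, (G.neighborFinset p).bipartiteAbove G.Adj x =
      (G.neighborFinset p).bipartiteBelow G.Adj x := by
    intro x; ext; simp [bipartiteAbove, bipartiteBelow, adj_comm]
  simp_rw [h4] at h2
  have h5 := h.degree_add p
  have h6 := h.degree_add s
  rw [inter_comm (G.far p)]
  omega

end SimpleGraph.IsNearRegular
end

section
variable {V : Type*} [Fintype V] {G : SimpleGraph V} [DecidableRel G.Adj]

namespace SimpleGraph.IsNearRegular
variable {q : ℕ} {ε : V → ℕ}

theorem card_defect_le (h : G.IsNearRegular q ε) : #{v | ε v ≠ 0} + 1 ≤ q := by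
  have h1 : #{v | ε v ≠ 0} ≤ ∑ v, ε v := by
    rw [card_filter]
    exact sum_le_sum fun v _ => by split_ifs <;> omega
  have := h.sum_lt
  omega

theorem eq_one_of_card_defect (h : G.IsNearRegular q ε) (hc : q ≤ #{v | ε v ≠ 0} + 1) (v : V)
    (hv : ε v ≠ 0) : ε v = 1 := by
  by_contra hv1
  have h1 : #{v | ε v ≠ 0} < ∑ v, ε v := by
    rw [card_filter]
    exact sum_lt_sum (fun v _ => by split_ifs <;> omega) ⟨v, mem_univ _, by rw [if_pos hv]; omega⟩
  have := h.sum_lt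
  omega

end SimpleGraph.IsNearRegular
end

/-! ### Vertices without defect have a common neighbour -/

section
variable {V : Type*} [Fintype V] [DecidableEq V] {G : SimpleGraph V} [DecidableRel G.Adj]

namespace SimpleGraph

theorem not_adj_of_mem_far {s w u : V} (h : w ∈ G.far s) (h1 : G.Adj s u) : ¬ G.Adj w u :=
  (mem_far.1 h).2 u h1

theorem exists_adj_adj_of_notMem_far {s w : V} (hne : w ≠ s) (h : w ∉ G.far s) :
    ∃ u, G.Adj s u ∧ G.Adj w u := by
  by_contra hc
  push Not at hc
  exact h (mem_far.2 ⟨hne, hc⟩)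

variable (G) in
/-- `u` is a neighbour of `y` without defect whose only defective neighbour is the neighbour `t`
of `y`, and `t` has defect one. -/
structure PrivatePair (ε : V → ℕ) (y u t : V) : Prop where
  adj_left : G.Adj y u
  adj_right : G.Adj y t
  adj : G.Adj u t
  left_eq : ε u = 0
  right_eq : ε t = 1
  unique : ∀ t', G.Adj u t' → ε t' ≠ 0 → t' = t

namespace IsNearRegular
variable {q : ℕ} {ε : V → ℕ}

theorem card_inter_far_of_eq_zero (h : G.IsNearRegular q ε) {p s : V} (hps : ¬ G.Adj p s)
    (hp : ε p = 0) : #(G.neighborFinset p ∩ G.far s) = ε s + #(G.far p ∩ G.neighborFinset s) := by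
  simpa [hp] using h.card_inter_far_add hps

theorem far_nonempty_of_adj (h : G.IsNearRegular q ε) {y y' u : V} (hy' : ε y' = 0)
    (hf : y' ∈ G.far y) (hu : G.Adj y u) (hu0 : ε u = 0) :
    1 ≤ #(G.neighborFinset u ∩ G.far y') ∧
      #(G.neighborFinset u ∩ G.far y') = #(G.far u ∩ G.neighborFinset y') := by
  have h1 : ¬ G.Adj u y' := fun e => not_adj_of_mem_far hf hu e.symm
  have h2 := h.card_inter_far_of_eq_zero h1 hu0
  rw [hy', zero_add] at h2
  refine ⟨card_pos.2 ⟨y, mem_inter.2 ⟨?_, mem_far_comm.1 hf⟩⟩, h2⟩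
  simpa using hu.symm

/-- Every neighbour of y outside all private pairs is charged to a defective vertex t, and t
receives at most ε(t) charges. So at most q - 1 of the q + 1 neighbours of y are charged. -/
theorem exists_privatePairs (h : G.IsNearRegular q ε) {y y' : V} (hy : ε y = 0) (hy' : ε y' = 0)
    (hf : y' ∈ G.far y) :
    ∃ u₁ t₁ u₂ t₂, u₁ ≠ u₂ ∧ G.PrivatePair ε y u₁ t₁ ∧ G.PrivatePair ε y u₂ t₂ := by
  classical
  suffices hs : 2 ≤ #{u ∈ G.neighborFinset y | ∃ t, G.PrivatePair ε y u t} by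
    obtain ⟨u₁, h1, u₂, h2, hne⟩ := one_lt_card.1 hs
    obtain ⟨-, t₁, h1⟩ := mem_filter.1 h1
    obtain ⟨-, t₂, h2⟩ := mem_filter.1 h2
    exact ⟨u₁, t₁, u₂, t₂, hne, h1, h2⟩
  have hex : ∀ v ∈ G.neighborFinset y, ¬ (∃ t, G.PrivatePair ε y v t) →
      ∃ t, ε t ≠ 0 ∧ (v = t ∨ G.Adj v t ∧ (¬ G.Adj y t ∨ 2 ≤ ε t)) := by
    intro v hv hp
    rw [mem_neighborFinset] at hv
    by_cases hv0 : ε v = 0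
    · by_contra hc
      push Not at hc
      -- `far v` is non-empty, so `card_far` gives v a defective neighbour. If all of these are
      -- adjacent to y with defect one, there is just one, and v forms a private pair with it.
      obtain ⟨h1, h2⟩ := h.far_nonempty_of_adj hy' hf hv hv0
      have h3 : 0 < #(G.far v) :=
        lt_of_lt_of_le (by omega) (card_le_card (inter_subset_left (s₂ := G.neighborFinset y')))
      rw [h.card_far, hv0, mul_zero, zero_add, sum_pos_iff] at h3
      obtain ⟨t, ht, ht0⟩ := h3
      rw [mem_neighborFinset] at ht
      have h4 := (hc t ht0.ne').2 ht
      refine hp ⟨t, hv, h4.1, ht, hv0, by omega, fun t' ht' ht0' => ?_⟩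
      exact h.quadFree hv.ne ((hc t' ht0').2 ht').1 ht' h4.1 ht
    · exact ⟨v, hv0, Or.inl rfl⟩
  choose! g hg using hex
  have h1 : #{u ∈ G.neighborFinset y | ¬ ∃ t, G.PrivatePair ε y u t} ≤ ∑ t, ε t := by
    rw [card_eq_sum_card_fiberwise (f := g) (t := univ) (fun _ _ => mem_coe.2 (mem_univ _))]
    refine sum_le_sum fun t _ => ?_
    have hin : ∀ v ∈ filter (g · = t) {u ∈ G.neighborFinset y | ¬ ∃ t, G.PrivatePair ε y u t},
        G.Adj y v ∧ ε t ≠ 0 ∧ (v = t ∨ G.Adj v t ∧ (¬ G.Adj y t ∨ 2 ≤ ε t)) := by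
      intro v hv
      simp only [mem_filter, mem_neighborFinset] at hv
      have := hg v (by simpa using hv.1.1) hv.1.2
      rw [hv.2] at this
      exact ⟨hv.1.1, this⟩
    rcases Nat.lt_trichotomy (ε t) 1 with ht | ht | ht
    · rw [card_eq_zero.2]
      · omega
      · rw [eq_empty_iff_forall_notMem]
        intro v hv
        exact (hin v hv).2.1 (by omega)
    · rw [ht, card_le_one]
      intro a ha b hb
      have h1 := hin a ha
      have h2 := hin b hb
      by_cases hyt : G.Adj y t
      · have h3 : a = t := by
          rcases h1.2.2 with h | h
          · exact h
          · rcases h.2 with h | h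
            · exact absurd hyt h
            · omega
        have h4 : b = t := by
          rcases h2.2.2 with h | h
          · exact h
          · rcases h.2 with h | h
            · exact absurd hyt h
            · omega
        rw [h3, h4]
      · have h3 : G.Adj a t := by
          rcases h1.2.2 with h | h
          · exact absurd (h ▸ h1.1) hyt
          · exact h.1
        have h4 : G.Adj b t := by
          rcases h2.2.2 with h | h
          · exact absurd (h ▸ h2.1) hyt
          · exact h.1
        exact h.quadFree (a := y) (b := t) (fun e => by rw [e] at hy; omega)
          h1.1 h3.symm h2.1 h4.symm
    · have hyt : y ≠ t := fun e => by rw [e] at hy; omega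
      calc _ ≤ #(insert t (G.neighborFinset y ∩ G.neighborFinset t)) := by
            refine card_le_card fun v hv => ?_
            have h1 := hin v hv
            rw [mem_insert, mem_inter, mem_neighborFinset, mem_neighborFinset]
            exact h1.2.2.imp id fun h2 => ⟨h1.1, h2.1.symm⟩
        _ ≤ #(G.neighborFinset y ∩ G.neighborFinset t) + 1 := card_insert_le _ _
        _ ≤ 1 + 1 := by gcongr; exact h.quadFree.card_inter_neighborFinset_le hyt
        _ ≤ _ := ht
  have h2 := card_filter_add_card_filter_not (s := G.neighborFinset y)
    (fun u => ∃ t, G.PrivatePair ε y u t)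
  rw [card_neighborFinset_eq_degree] at h2
  have h3 := h.degree_add y
  have h4 := h.sum_lt
  omega

/-- The unique vertex having no common neighbour with a vertex `u` without defect, when `u` has
exactly one defective neighbour, of defect one. -/
theorem exists_far_eq_singleton (h : G.IsNearRegular q ε) {u t : V} (hu : ε u = 0)
    (hut : G.Adj u t) (ht : ε t = 1) (huniq : ∀ t', G.Adj u t' → ε t' ≠ 0 → t' = t) :
    ∃ z, G.far u = {z} ∧ ¬ G.Adj z t ∧ ∀ x ∈ G.far t, ε x = 0 → G.Adj z x := by
  -- In the sum of `card_far` only the term of t survives.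
  have h1 : #(G.far u) = 1 := by
    rw [h.card_far, hu, mul_zero, zero_add, sum_eq_single t, ht]
    · intro b hb hbt
      by_contra hb0
      exact hbt (huniq b (by simpa using hb) hb0)
    · intro hh
      exact absurd (by simpa using hut) hh
  obtain ⟨z, hz⟩ := card_eq_one.1 h1
  refine ⟨z, hz, fun hzt => ?_, fun x hx hx0 => ?_⟩
  · have : z ∈ G.far u := by rw [hz]; exact mem_singleton_self z
    exact not_adj_of_mem_far this hut hzt
  · have hux : ¬ G.Adj u x := fun e => not_adj_of_mem_far hx hut.symm e.symm
    have h2 := h.card_inter_far_of_eq_zero hux hu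
    rw [hx0, zero_add, hz] at h2
    have h3 : 0 < #(G.neighborFinset u ∩ G.far x) :=
      card_pos.2 ⟨t, mem_inter.2 ⟨by simpa using hut, mem_far_comm.1 hx⟩⟩
    rw [h2, card_pos] at h3
    obtain ⟨w, hw⟩ := h3
    simp only [mem_inter, mem_singleton, mem_neighborFinset] at hw
    exact hw.1 ▸ hw.2.symm

/-- Here w is the common neighbour of t and y'. A non-defective neighbour of y' other than z and w
is not adjacent to t, so by `card_inter_far_of_eq_zero` it has a neighbour far from t, because t has
defect one. Choosing one for each gives an injection into `far t` that avoids N(z), whence the final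
inequality. -/
theorem privatePair_spec (h : G.IsNearRegular q ε) {y y' u t : V} (hy' : ε y' = 0)
    (hf : y' ∈ G.far y) (hp : G.PrivatePair ε y u t) :
    ∃ z w, z ≠ w ∧ G.far u = {z} ∧ G.Adj z y' ∧ ¬ G.Adj z t ∧ G.Adj t w ∧ G.Adj y' w ∧
      (∀ x ∈ G.far t, ε x = 0 → G.Adj z x) ∧
      #(G.neighborFinset y' \ ({z, w} ∪ ({v | ε v ≠ 0} : Finset V))) ≤
        #(G.far t \ G.neighborFinset z) := by
  obtain ⟨z, hz, hzt, hx⟩ := h.exists_far_eq_singleton hp.left_eq hp.adj hp.right_eq hp.unique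
  obtain ⟨h1, h2⟩ := h.far_nonempty_of_adj hy' hf hp.adj_left hp.left_eq
  have hle : #(G.far u ∩ G.neighborFinset y') ≤ 1 := by
    rw [hz]; exact (card_le_card inter_subset_left).trans (card_singleton z).le
  have hzy : G.Adj z y' := by
    rw [h2, Nat.succ_le_iff, card_pos] at h1
    obtain ⟨w, hw⟩ := h1
    rw [hz] at hw
    simp only [mem_inter, mem_singleton, mem_neighborFinset] at hw
    exact hw.1 ▸ hw.2.symm
  -- Otherwise y and t would be two vertices of N(u) far from y', where there is only one.
  have hty : y' ∉ G.far t := by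
    intro hc
    rw [← h2, card_le_one] at hle
    refine hp.adj_right.ne (hle y ?_ t ?_)
    · rw [mem_inter, mem_neighborFinset]
      exact ⟨hp.adj_left.symm, mem_far_comm.1 hf⟩
    · rw [mem_inter, mem_neighborFinset]
      exact ⟨hp.adj, mem_far_comm.1 hc⟩
  have hyt : y' ≠ t := fun e => by have := hp.right_eq; rw [← e] at this; omega
  obtain ⟨w, hw1, hw2⟩ := exists_adj_adj_of_notMem_far hyt hty
  refine ⟨z, w, ?_, hz, hzy, hzt, hw1, hw2, hx, ?_⟩
  · rintro rfl; exact hzt hw1.symm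
  · have hex : ∀ v ∈ G.neighborFinset y' \ ({z, w} ∪ ({v | ε v ≠ 0} : Finset V)),
        ∃ x, x ∈ G.far t ∧ G.Adj v x := by
      intro v hv
      simp only [mem_sdiff, mem_neighborFinset, mem_union, mem_insert, mem_singleton, mem_filter,
        mem_univ, true_and, not_or, not_not] at hv
      have hvt : ¬ G.Adj v t := fun e =>
        hv.2.1.2 (h.quadFree hyt hv.1 e.symm hw2 hw1)
      have h3 := h.card_inter_far_of_eq_zero hvt hv.2.2
      rw [hp.right_eq] at h3
      have h4 : 0 < #(G.neighborFinset v ∩ G.far t) := by omega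
      obtain ⟨x, hx⟩ := card_pos.1 h4
      rw [mem_inter, mem_neighborFinset] at hx
      exact ⟨x, hx.2, hx.1⟩
    choose! g hg using hex
    have hgy : ∀ v ∈ G.neighborFinset y' \ ({z, w} ∪ ({v | ε v ≠ 0} : Finset V)), g v ≠ y' :=
      fun v hv e => hty (e ▸ (hg v hv).1)
    refine card_le_card_of_injOn g ?_ ?_
    · intro v hv
      have h1 := hg v hv
      have h2 := hgy v hv
      simp only [coe_sdiff, Set.mem_sdiff, mem_coe, mem_neighborFinset, mem_union, mem_insert,
        mem_singleton, not_or] at hv ⊢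
      refine ⟨h1.1, fun e => hv.2.1.1 ?_⟩
      exact h.quadFree h2.symm hv.1 h1.2.symm hzy.symm e.symm
    · intro v hv v' hv' e
      have h1 := hg v hv
      have h2 := hgy v hv
      have h3 := hg v' hv'
      rw [mem_coe, mem_sdiff, mem_neighborFinset] at hv hv'
      exact h.quadFree h2.symm hv.1 h1.2.symm hv'.1 (e ▸ h3.2.symm)

theorem far_sdiff_subset {y z t : V} (hyt : G.Adj y t)
    (hx : ∀ x ∈ G.far t, ε x = 0 → G.Adj z x) :
    G.far t \ G.neighborFinset z ⊆ ({v | ε v ≠ 0} : Finset V) \ G.neighborFinset y := by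
  intro r hr
  simp only [mem_sdiff, mem_neighborFinset, mem_filter, mem_univ, true_and] at hr ⊢
  exact ⟨fun e => hr.2 (hx r hr.1 e), fun e => not_adj_of_mem_far hr.1 hyt.symm e.symm⟩

/-- At least q + 1 - 2 - |S ∩ N(y')| neighbours of y' inject into S \ N(y), and |S| ≤ q - 1. The
roles of y and y' can be exchanged, so equality holds, and this forces every estimate used here to
be sharp. -/
theorem card_defect_inter_le (h : G.IsNearRegular q ε) {y y' : V} (hy : ε y = 0) (hy' : ε y' = 0)
    (hf : y' ∈ G.far y) :
    #(({v | ε v ≠ 0} : Finset V) ∩ G.neighborFinset y) ≤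
      #(({v | ε v ≠ 0} : Finset V) ∩ G.neighborFinset y') := by
  obtain ⟨u, t, -, -, -, hp, -⟩ := h.exists_privatePairs hy hy' hf
  obtain ⟨z, w, hzw, -, hzy, -, hw1, hw2, hx, hle⟩ := h.privatePair_spec hy' hf hp
  have h1 := card_le_card (far_sdiff_subset hp.adj_right hx)
  have h2 := card_sdiff_add_card_inter ({v | ε v ≠ 0} : Finset V) (G.neighborFinset y)
  have h3 := card_sdiff_add_card_inter (G.neighborFinset y')
    ({z, w} ∪ ({v | ε v ≠ 0} : Finset V))
  have h4 : #(G.neighborFinset y' ∩ ({z, w} ∪ ({v | ε v ≠ 0} : Finset V))) ≤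
      2 + #(({v | ε v ≠ 0} : Finset V) ∩ G.neighborFinset y') := by
    rw [inter_union_distrib_left, inter_comm _ (filter _ _)]
    refine (card_union_le _ _).trans (Nat.add_le_add_right ?_ _)
    exact (card_le_card inter_subset_right).trans card_le_two
  have h5 := h.degree_add y'
  rw [card_neighborFinset_eq_degree] at h3
  have h6 := h.card_defect_le
  omega

/-- Sharpness gives |S| = q - 1, all defects one, z and w non-defective, and `far t` ∩ S = S \ N(y).
Writing τ = |S ∩ N(t)| and α = |S ∩ N(y)|, `card_far` gives |far t \ S| = τ + α + 1. This bounds the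
number of neighbours of z far from t, hence by `card_inter_far_of_eq_zero` that of neighbours of t
far from z. These include all of N(t) except y and the τ defective vertices. -/
theorem le_two_mul_card_defect (h : G.IsNearRegular q ε) {y y' u t : V} (hy : ε y = 0)
    (hy' : ε y' = 0) (hf : y' ∈ G.far y) (hp : G.PrivatePair ε y u t) :
    q ≤ 2 * #(({v | ε v ≠ 0} : Finset V) ∩ G.neighborFinset t) +
        #(({v | ε v ≠ 0} : Finset V) ∩ G.neighborFinset y) + 1 ∧
      Disjoint (({v | ε v ≠ 0} : Finset V) ∩ G.neighborFinset t) (G.neighborFinset y') ∧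
      q ≤ #({v | ε v ≠ 0} : Finset V) + 1 := by
  set S : Finset V := {v | ε v ≠ 0} with hS
  have memS : ∀ v, v ∈ S ↔ ε v ≠ 0 := fun v => by simp [hS]
  have hα := h.card_defect_inter_le hy hy' hf
  have hα' := h.card_defect_inter_le hy' hy (mem_far_comm.1 hf)
  rw [← hS] at hα hα'
  obtain ⟨z, w, hzw, hz, hzy, hzt, hw1, hw2, hx, hle⟩ := h.privatePair_spec hy' hf hp
  rw [← hS] at hle
  have hsub := far_sdiff_subset hp.adj_right hx
  rw [← hS] at hsub
  have h1 := card_le_card hsub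
  have h2 := card_sdiff_add_card_inter S (G.neighborFinset y)
  have h3 := card_sdiff_add_card_inter (G.neighborFinset y') ({z, w} ∪ S)
  have h4 := card_union_add_card_inter (G.neighborFinset y' ∩ {z, w}) (S ∩ G.neighborFinset y')
  have h4' : #(G.neighborFinset y' ∩ {z, w}) ≤ 2 :=
    (card_le_card inter_subset_right).trans card_le_two
  have h5 := h.degree_add y'
  rw [card_neighborFinset_eq_degree, inter_union_distrib_left, inter_comm _ S] at h3
  have h6 := h.card_defect_le
  rw [← hS] at h6
  have hm : q ≤ #S + 1 := by omega
  have hR : G.far t \ G.neighborFinset z = S \ G.neighborFinset y :=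
    eq_of_subset_of_card_le hsub (by omega)
  have hzwS : (G.neighborFinset y' ∩ {z, w}) ∩ (S ∩ G.neighborFinset y') = ∅ := by
    rw [← card_eq_zero]; omega
  have hone := h.eq_one_of_card_defect hm
  have hz0 : ε z = 0 := by
    by_contra hc
    have : z ∈ (G.neighborFinset y' ∩ {z, w}) ∩ (S ∩ G.neighborFinset y') := by
      simp [memS, hc, hzy.symm]
    rw [hzwS] at this; simp at this
  have hw0 : ε w = 0 := by
    by_contra hc
    have : w ∈ (G.neighborFinset y' ∩ {z, w}) ∩ (S ∩ G.neighborFinset y') := by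
      simp [memS, hc, hw2]
    rw [hzwS] at this; simp at this
  have hyt' : y' ≠ t := fun e => by have := hp.right_eq; rw [← e] at this; omega
  refine ⟨?_, ?_, hm⟩
  swap
  · rw [Finset.disjoint_left]
    intro v hv hv'
    rw [mem_inter, mem_neighborFinset, memS] at hv
    rw [mem_neighborFinset] at hv'
    have := h.quadFree hyt' hv' hv.2 hw2 hw1
    exact hv.1 (this ▸ hw0)
  have hfarS : G.far t ∩ S = S \ G.neighborFinset y := by
    ext r
    rw [← hR]
    simp only [mem_inter, mem_sdiff]
    constructor
    · rintro ⟨h1, h2⟩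
      have : r ∈ S \ G.neighborFinset y := by
        rw [mem_sdiff, mem_neighborFinset]
        exact ⟨h2, fun e => not_adj_of_mem_far h1 hp.adj_right.symm e.symm⟩
      rw [← hR, mem_sdiff] at this
      exact this
    · rintro ⟨h1, h2⟩
      have : r ∈ S \ G.neighborFinset y := by rw [← hR, mem_sdiff]; exact ⟨h1, h2⟩
      exact ⟨h1, (mem_sdiff.1 this).1⟩
  have hfar := card_sdiff_add_card_inter (G.far t) S
  rw [hfarS, h.card_far, hp.right_eq, mul_one] at hfar
  have hσ : ∑ v ∈ G.neighborFinset t, ε v = #(S ∩ G.neighborFinset t) := by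
    rw [inter_comm, ← filter_mem_eq_inter, card_filter]
    refine sum_congr rfl fun v _ => ?_
    split_ifs with hv
    · exact hone v ((memS v).1 hv)
    · simpa [memS] using hv
  rw [hσ] at hfar
  have hα1 : 1 ≤ #(S ∩ G.neighborFinset y) :=
    card_pos.2 ⟨t, by rw [mem_inter, memS, mem_neighborFinset]; exact ⟨by rw [hp.right_eq]; simp,
      hp.adj_right⟩⟩
  -- Such a v has t as its only defective neighbour, so `far v` is a single vertex adjacent to all
  -- of `far t` \ S. That set has at least two elements, all adjacent to z as well, so the vertex is
  -- z.
  have hpure : ∀ v ∈ G.neighborFinset t, v ≠ y → v ∉ S → v ∈ G.far z := by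
    intro v hv hvy hvS
    rw [mem_neighborFinset] at hv
    have hv0 : ε v = 0 := by simpa [memS] using hvS
    have huniq : ∀ t', G.Adj v t' → ε t' ≠ 0 → t' = t := by
      intro t' ht' ht0
      by_contra hne
      have h1 : t' ∉ G.far t := fun e => not_adj_of_mem_far e hv ht'.symm
      have h2 : t' ∉ S \ G.neighborFinset y := by
        rw [← hfarS, mem_inter]; exact fun e => h1 e.1
      rw [mem_sdiff, memS, mem_neighborFinset] at h2
      push Not at h2
      exact hvy (h.quadFree hne ht'.symm hv (h2 ht0).symm hp.adj_right.symm)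
    obtain ⟨z', hz', -, hx'⟩ := h.exists_far_eq_singleton hv0 hv.symm hp.right_eq huniq
    have h7 : 2 ≤ #(G.far t \ S) := by omega
    obtain ⟨a, ha, b, hb, hab⟩ := one_lt_card.1 h7
    rw [mem_sdiff, memS, not_not] at ha hb
    have : z' = z := h.quadFree hab (hx' a ha.1 ha.2).symm (hx' b hb.1 hb.2).symm
      (hx a ha.1 ha.2).symm (hx b hb.1 hb.2).symm
    rw [mem_far_comm, hz', this]
    exact mem_singleton_self z
  have h8 := h.card_inter_far_of_eq_zero hzt hz0
  rw [hp.right_eq] at h8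
  have h9 : #(G.neighborFinset z ∩ G.far t) ≤ #(G.far t \ S) := by
    refine card_le_card fun v hv => ?_
    rw [mem_inter] at hv
    rw [mem_sdiff]
    refine ⟨hv.2, fun hvS => ?_⟩
    have : v ∈ S \ G.neighborFinset y := by rw [← hfarS, mem_inter]; exact ⟨hv.2, hvS⟩
    rw [← hR, mem_sdiff] at this
    exact this.2 hv.1
  have h10 : #(G.neighborFinset t) ≤ #(G.far z ∩ G.neighborFinset t) +
      #(S ∩ G.neighborFinset t) + 1 := by
    calc _ ≤ #(insert y ((G.far z ∩ G.neighborFinset t) ∪ (S ∩ G.neighborFinset t))) := by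
          refine card_le_card fun v hv => ?_
          simp only [mem_insert, mem_union, mem_inter]
          by_cases h1 : v = y
          · exact Or.inl h1
          by_cases h2 : v ∈ S
          · exact Or.inr (Or.inr ⟨h2, hv⟩)
          · exact Or.inr (Or.inl ⟨hpure v hv h1 h2, hv⟩)
      _ ≤ _ := (card_insert_le _ _).trans (Nat.add_le_add_right (card_union_le _ _) 1)
  rw [card_neighborFinset_eq_degree] at h10
  have h11 := h.degree_add t
  rw [hp.right_eq] at h11
  omega

/-- Two vertices without defect have a common neighbour. -/
theorem exists_common_neighbor (h : G.IsNearRegular q ε) {y y' : V} (hne : y' ≠ y) (hy : ε y = 0)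
    (hy' : ε y' = 0) : ∃ u, G.Adj y u ∧ G.Adj y' u := by
  refine exists_adj_adj_of_notMem_far hne fun hf => ?_
  obtain ⟨u₁, t₁, u₂, t₂, hu, hp₁, hp₂⟩ := h.exists_privatePairs hy hy' hf
  obtain ⟨h1, d1, hm⟩ := h.le_two_mul_card_defect hy hy' hf hp₁
  obtain ⟨h2, d2, -⟩ := h.le_two_mul_card_defect hy hy' hf hp₂
  have hα' := h.card_defect_inter_le hy hy' hf
  have h6 := h.card_defect_le
  set S : Finset V := {v | ε v ≠ 0} with hS
  have memS : ∀ v, v ∈ S ↔ ε v ≠ 0 := fun v => by simp [hS]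
  have ht : t₁ ≠ t₂ := by
    rintro rfl
    exact hu (h.quadFree hp₁.adj_right.ne hp₁.adj_left hp₁.adj.symm hp₂.adj_left hp₂.adj.symm)
  have e : ∀ u t, G.PrivatePair ε y u t → Disjoint (S ∩ G.neighborFinset t) (G.neighborFinset y) := by
    intro u t hp
    rw [Finset.disjoint_left]
    intro v hv hv'
    rw [mem_inter, mem_neighborFinset, memS] at hv
    rw [mem_neighborFinset] at hv'
    have := h.quadFree hp.adj_right.ne hv' hv.2 hp.adj_left hp.adj.symm
    exact hv.1 (this ▸ hp.left_eq)
  have d12 : Disjoint (S ∩ G.neighborFinset t₁) (S ∩ G.neighborFinset t₂) := by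
    rw [Finset.disjoint_left]
    intro v hv hv'
    rw [mem_inter, mem_neighborFinset, memS] at hv hv'
    have := h.quadFree ht hv.2 hv'.2 hp₁.adj_right.symm hp₂.adj_right.symm
    exact hv.1 (this ▸ hy)
  have dyy : Disjoint (S ∩ G.neighborFinset y) (S ∩ G.neighborFinset y') := by
    rw [Finset.disjoint_left]
    intro v hv hv'
    rw [mem_inter, mem_neighborFinset] at hv hv'
    exact not_adj_of_mem_far hf hv.2 hv'.2
  have hα1 : 1 ≤ #(S ∩ G.neighborFinset y) :=
    card_pos.2 ⟨t₁, by
      rw [mem_inter, memS, mem_neighborFinset]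
      exact ⟨by rw [hp₁.right_eq]; simp, hp₁.adj_right⟩⟩
  -- Four disjoint subsets of S give τ₁ + τ₂ + 2α ≤ q - 1, while adding the bounds q ≤ 2τᵢ + α + 1
  -- gives q - 1 ≤ τ₁ + τ₂ + α. Since t₁ shows α ≥ 1, this is a contradiction.
  have hc : #(((S ∩ G.neighborFinset t₁) ∪ (S ∩ G.neighborFinset t₂)) ∪
      ((S ∩ G.neighborFinset y) ∪ (S ∩ G.neighborFinset y'))) ≤ #S :=
    card_le_card (union_subset (union_subset inter_subset_left inter_subset_left)
      (union_subset inter_subset_left inter_subset_left))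
  rw [card_union_of_disjoint, card_union_of_disjoint d12, card_union_of_disjoint dyy] at hc
  · omega
  · rw [disjoint_union_left, disjoint_union_right, disjoint_union_right]
    exact ⟨⟨(e _ _ hp₁).mono_right inter_subset_right, d1.mono_right inter_subset_right⟩,
      ⟨(e _ _ hp₂).mono_right inter_subset_right, d2.mono_right inter_subset_right⟩⟩

end IsNearRegular
end SimpleGraph
end

/-! ### Completing a partial projective plane -/

section
variable {V : Type*} [Fintype V] [DecidableEq V]

/-- A family of lines of size `q + 1` on `q² + q + 1` points, any two of which meet in exactly one
point, and which lacks `m < q` lines to be a projective plane. -/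
structure IsPartialPlane (𝓕 : Finset (Finset V)) (q m : ℕ) : Prop where
  card_points : Fintype.card V = q ^ 2 + q + 1
  card_lines : #𝓕 + m = q ^ 2 + q + 1
  lt : m < q
  card_line (L) (hL : L ∈ 𝓕) : #L = q + 1
  card_inter (L) (hL : L ∈ 𝓕) (L') (hL' : L' ∈ 𝓕) (hne : L ≠ L') : #(L ∩ L') = 1

/-- The number of lines of `𝓕` through `v`. -/
def lineDegree (𝓕 : Finset (Finset V)) (v : V) : ℕ := #{L ∈ 𝓕 | v ∈ L}

/-- The points other than `v` that are on no line of `𝓕` with `v`. -/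
def unjoined (𝓕 : Finset (Finset V)) (v : V) : Finset V := {w | w ≠ v ∧ ∀ L ∈ 𝓕, v ∈ L → w ∉ L}

theorem mem_unjoined {𝓕 : Finset (Finset V)} {v w : V} :
    w ∈ unjoined 𝓕 v ↔ w ≠ v ∧ ∀ L ∈ 𝓕, v ∈ L → w ∉ L := by
  simp [unjoined]

theorem mem_unjoined_comm {𝓕 : Finset (Finset V)} {v w : V} :
    w ∈ unjoined 𝓕 v ↔ v ∈ unjoined 𝓕 w := by
  simp only [mem_unjoined]
  exact ⟨fun h => ⟨h.1.symm, fun L hL h1 h2 => h.2 L hL h2 h1⟩,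
    fun h => ⟨h.1.symm, fun L hL h1 h2 => h.2 L hL h2 h1⟩⟩

theorem sum_lineDegree {W : Type*} [DecidableEq W] (𝓕 : Finset (Finset W)) (X : Finset W) :
    ∑ v ∈ X, lineDegree 𝓕 v = ∑ L ∈ 𝓕, #(X ∩ L) := by
  have := sum_card_bipartiteAbove_eq_sum_card_bipartiteBelow (s := X) (t := 𝓕) fun v L => v ∈ L
  simpa only [lineDegree, bipartiteAbove, bipartiteBelow, filter_mem_eq_inter] using this

/-- The lines through a point determined by the points of line degree `q`. -/
def newLines (𝓕 : Finset (Finset V)) (q : ℕ) : Finset (Finset V) :=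
  ({v | lineDegree 𝓕 v = q} : Finset V).image fun v => insert v (unjoined 𝓕 v)

namespace IsPartialPlane
variable {𝓕 : Finset (Finset V)} {q m : ℕ}

theorem card_unjoined_add (h : IsPartialPlane 𝓕 q m) (v : V) :
    #(unjoined 𝓕 v) + q * lineDegree 𝓕 v = q * (q + 1) := by
  have h1 : (univ : Finset V) = insert v (unjoined 𝓕 v ∪
      ({L ∈ 𝓕 | v ∈ L} : Finset (Finset V)).biUnion fun L => L.erase v) := by
    ext w
    simp only [mem_univ, mem_insert, mem_union, mem_unjoined, mem_biUnion, mem_erase,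
      mem_filter, true_iff]
    by_cases hw : w = v
    · exact Or.inl hw
    · refine Or.inr ?_
      by_cases hc : ∃ L ∈ 𝓕, v ∈ L ∧ w ∈ L
      · obtain ⟨L, hL, h1, h2⟩ := hc
        exact Or.inr ⟨L, ⟨hL, h1⟩, hw, h2⟩
      · exact Or.inl ⟨hw, fun L hL h1 h2 => hc ⟨L, hL, h1, h2⟩⟩
  have h2 : #(({L ∈ 𝓕 | v ∈ L} : Finset (Finset V)).biUnion fun L => L.erase v) =
      q * lineDegree 𝓕 v := by
    rw [card_biUnion, sum_congr rfl (g := fun _ => q), sum_const, smul_eq_mul, mul_comm]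
    · rfl
    · intro L hL
      rw [mem_filter] at hL
      rw [card_erase_of_mem hL.2, h.card_line L hL.1, Nat.add_sub_cancel]
    · intro L hL L' hL' hne
      rw [mem_coe, mem_filter] at hL hL'
      rw [Function.onFun, Finset.disjoint_left]
      intro w hw hw'
      rw [mem_erase] at hw hw'
      exact hw.1 (card_le_one.1 (h.card_inter L hL.1 L' hL'.1 hne).le w
        (mem_inter.2 ⟨hw.2, hw'.2⟩) v (mem_inter.2 ⟨hL.2, hL'.2⟩))
  have h3 := congrArg card h1
  rw [card_univ, h.card_points, card_insert_of_notMem, card_union_of_disjoint, h2] at h3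
  · linarith
  · rw [Finset.disjoint_left]
    intro w hw hw'
    simp only [mem_biUnion, mem_erase, mem_filter] at hw'
    obtain ⟨L, hL, -, h4⟩ := hw'
    exact (mem_unjoined.1 hw).2 L hL.1 hL.2 h4
  · simp [mem_unjoined]

theorem lineDegree_le (h : IsPartialPlane 𝓕 q m) (v : V) : lineDegree 𝓕 v ≤ q + 1 := by
  have h1 := h.card_unjoined_add v
  have h2 := h.lt
  exact Nat.le_of_mul_le_mul_left (by omega : q * lineDegree 𝓕 v ≤ q * (q + 1)) (by omega)

/-- The lines through v meet C in one point each, distinct lines in distinct points; the remaining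
points of C are those unjoined to v. -/
theorem card_inter_unjoined_add (h : IsPartialPlane 𝓕 q m) {C : Finset V} {v : V} (hv : v ∉ C)
    (hC : ∀ L ∈ 𝓕, v ∈ L → #(C ∩ L) = 1) :
    #(C ∩ unjoined 𝓕 v) + lineDegree 𝓕 v = #C := by
  have h1 : C \ unjoined 𝓕 v = ({L ∈ 𝓕 | v ∈ L} : Finset (Finset V)).biUnion fun L => C ∩ L := by
    ext w
    simp only [mem_sdiff, mem_unjoined, mem_biUnion, mem_filter, mem_inter]
    constructor
    · rintro ⟨hw, h1⟩
      have hwv : w ≠ v := fun e => hv (e ▸ hw)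
      push Not at h1
      obtain ⟨L, hL, h2, h3⟩ := h1 hwv
      exact ⟨L, ⟨hL, h2⟩, hw, h3⟩
    · rintro ⟨L, ⟨hL, h2⟩, hw, h3⟩
      exact ⟨hw, fun h4 => h4.2 L hL h2 h3⟩
  have h2 : #(({L ∈ 𝓕 | v ∈ L} : Finset (Finset V)).biUnion fun L => C ∩ L) =
      lineDegree 𝓕 v := by
    rw [card_biUnion, lineDegree, card_eq_sum_ones]
    · refine sum_congr rfl fun L hL => ?_
      rw [mem_filter] at hL
      exact hC L hL.1 hL.2
    · intro L hL L' hL' hne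
      rw [mem_coe, mem_filter] at hL hL'
      rw [Function.onFun, Finset.disjoint_left]
      intro w hw hw'
      rw [mem_inter] at hw hw'
      have : w = v := card_le_one.1 (h.card_inter L hL.1 L' hL'.1 hne).le w
        (mem_inter.2 ⟨hw.2, hw'.2⟩) v (mem_inter.2 ⟨hL.2, hL'.2⟩)
      exact hv (this ▸ hw.1)
  have h3 := card_sdiff_add_card_inter C (unjoined 𝓕 v)
  rw [h1, h2] at h3
  omega

theorem card_newLine (h : IsPartialPlane 𝓕 q m) {C : Finset V} (hC : C ∈ newLines 𝓕 q) :
    #C = q + 1 := by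
  simp only [newLines, mem_image, mem_filter, mem_univ, true_and] at hC
  obtain ⟨v, hv, rfl⟩ := hC
  rw [card_insert_of_notMem (by simp [mem_unjoined])]
  have := h.card_unjoined_add v
  rw [hv] at this
  nlinarith

theorem card_newLine_inter (h : IsPartialPlane 𝓕 q m) {C L : Finset V} (hC : C ∈ newLines 𝓕 q)
    (hL : L ∈ 𝓕) : #(C ∩ L) = 1 := by
  simp only [newLines, mem_image, mem_filter, mem_univ, true_and] at hC
  obtain ⟨v, hv, rfl⟩ := hC
  by_cases hvL : v ∈ L
  · rw [card_eq_one]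
    refine ⟨v, ?_⟩
    ext w
    simp only [mem_inter, mem_insert, mem_singleton]
    constructor
    · rintro ⟨h1 | h1, h2⟩
      · exact h1
      · exact absurd h2 ((mem_unjoined.1 h1).2 L hL hvL)
    · rintro rfl
      exact ⟨Or.inl rfl, hvL⟩
  · have h1 := h.card_inter_unjoined_add hvL fun L' hL' hv' =>
      h.card_inter L hL L' hL' (fun e => hvL (e ▸ hv'))
    rw [h.card_line L hL, hv, inter_comm] at h1
    rw [insert_inter_of_notMem hvL]
    omega

theorem unjoined_of_newLine (h : IsPartialPlane 𝓕 q m) {C : Finset V} (hC : C ∈ newLines 𝓕 q)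
    {v w : V} (hv : v ∈ C) (hw : w ∈ C) (hne : w ≠ v) : w ∈ unjoined 𝓕 v := by
  rw [mem_unjoined]
  refine ⟨hne, fun L hL h1 h2 => hne ?_⟩
  exact card_le_one.1 (h.card_newLine_inter hC hL).le w (mem_inter.2 ⟨hw, h2⟩) v
    (mem_inter.2 ⟨hv, h1⟩)

theorem newLine_eq (h : IsPartialPlane 𝓕 q m) {C : Finset V} (hC : C ∈ newLines 𝓕 q)
    {v : V} (hv : v ∈ C) (hd : lineDegree 𝓕 v = q) : C = insert v (unjoined 𝓕 v) := by
  apply eq_of_subset_of_card_le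
  · intro w hw
    by_cases hne : w = v
    · exact mem_insert.2 (Or.inl hne)
    · exact mem_insert_of_mem (h.unjoined_of_newLine hC hv hw hne)
  · rw [h.card_newLine hC, h.card_newLine]
    exact mem_image_of_mem _ (by simpa using hd)

theorem card_newLine_inter_newLine_le (h : IsPartialPlane 𝓕 q m) {C C' : Finset V}
    (hC : C ∈ newLines 𝓕 q) (hC' : C' ∈ newLines 𝓕 q) (hne : C ≠ C') : #(C ∩ C') ≤ 1 := by
  have hC0 := hC
  simp only [newLines, mem_image, mem_filter, mem_univ, true_and] at hC
  obtain ⟨v, hv, rfl⟩ := hC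
  have hvC : v ∉ C' := fun hvC => hne (h.newLine_eq hC' hvC hv).symm
  have h1 := h.card_inter_unjoined_add hvC fun L hL _ => h.card_newLine_inter hC' hL
  rw [h.card_newLine hC', hv] at h1
  rw [insert_inter_of_notMem hvC, inter_comm]
  omega

/-- Incidences of the lines with the points unjoined to v are counted in two ways. A point not
covered by a new line through v has line degree at most q - 1, which is below the average required.
-/
theorem newLines_cover (h : IsPartialPlane 𝓕 q m) (v : V) :
    #{C ∈ newLines 𝓕 q | v ∈ C} + lineDegree 𝓕 v = q + 1 ∧
      ∀ w ∈ unjoined 𝓕 v, ∃ C ∈ newLines 𝓕 q, v ∈ C ∧ w ∈ C := by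
  set 𝒞 : Finset (Finset V) := {C ∈ newLines 𝓕 q | v ∈ C} with h𝒞
  have mem𝒞 : ∀ C, C ∈ 𝒞 ↔ C ∈ newLines 𝓕 q ∧ v ∈ C := fun C => by simp [h𝒞]
  set X := 𝒞.biUnion fun C => C.erase v with hX
  have hXK : X ⊆ unjoined 𝓕 v := by
    intro w hw
    simp only [hX, mem_biUnion, mem_erase, mem𝒞] at hw
    obtain ⟨C, ⟨hC, hv⟩, hne, hw⟩ := hw
    exact h.unjoined_of_newLine hC hv hw hne
  have hdisj : Set.PairwiseDisjoint (𝒞 : Set (Finset V)) fun C => C.erase v := by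
    intro C hC C' hC' hne
    rw [mem_coe, mem𝒞] at hC hC'
    rw [Function.onFun, Finset.disjoint_left]
    intro w hw hw'
    rw [mem_erase] at hw hw'
    exact hw.1 (card_le_one.1 (h.card_newLine_inter_newLine_le hC.1 hC'.1 hne) w
      (mem_inter.2 ⟨hw.2, hw'.2⟩) v (mem_inter.2 ⟨hC.2, hC'.2⟩))
  have hXc : #X = #𝒞 * q := by
    rw [hX, card_biUnion hdisj, sum_congr rfl (g := fun _ => q), sum_const, smul_eq_mul]
    intro C hC
    rw [mem𝒞] at hC
    rw [card_erase_of_mem hC.2, h.card_newLine hC.1, Nat.add_sub_cancel]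
  have hXs : ∑ w ∈ X, lineDegree 𝓕 w + #𝒞 * lineDegree 𝓕 v = #𝒞 * #𝓕 := by
    rw [hX, sum_biUnion hdisj, ← smul_eq_mul (#𝒞), ← sum_const, ← sum_add_distrib,
      sum_congr rfl (g := fun _ => #𝓕), sum_const, smul_eq_mul]
    intro C hC
    rw [mem𝒞] at hC
    rw [sum_erase_add _ _ hC.2, sum_lineDegree, card_eq_sum_ones]
    exact sum_congr rfl fun L hL => h.card_newLine_inter hC.1 hL
  set U := unjoined 𝓕 v \ X with hU
  -- A point of line degree q + 1 is joined to every point, and one of line degree q would generate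
  -- a new line through v.
  have hUs : ∑ w ∈ U, lineDegree 𝓕 w ≤ #U * (q - 1) := by
    rw [← smul_eq_mul, ← sum_const]
    refine sum_le_sum fun w hw => ?_
    rw [hU, mem_sdiff] at hw
    have h1 := h.lineDegree_le w
    have h2 : lineDegree 𝓕 w ≠ q + 1 := by
      intro e
      have h3 := h.card_unjoined_add w
      rw [e] at h3
      have h4 : 0 < #(unjoined 𝓕 w) := card_pos.2 ⟨v, mem_unjoined_comm.1 hw.1⟩
      omega
    have h3 : lineDegree 𝓕 w ≠ q := by
      intro e
      apply hw.2
      rw [hX, mem_biUnion]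
      refine ⟨insert w (unjoined 𝓕 w), ?_, ?_⟩
      · rw [mem𝒞]
        exact ⟨mem_image_of_mem _ (by simpa using e),
          mem_insert_of_mem (mem_unjoined_comm.1 hw.1)⟩
      · exact mem_erase.2 ⟨(mem_unjoined.1 hw.1).1, mem_insert_self _ _⟩
    omega
  -- A line through v contains no point unjoined to v; any other line contains q + 1 - `lineDegree 𝓕
  -- v` of them.
  have hKs : ∑ w ∈ unjoined 𝓕 v, lineDegree 𝓕 w =
      (q + 1 - lineDegree 𝓕 v) * (#𝓕 - lineDegree 𝓕 v) := by
    rw [sum_lineDegree, ← sum_filter_add_sum_filter_not 𝓕 (v ∈ ·), sum_eq_zero, zero_add,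
      sum_congr rfl (g := fun _ => q + 1 - lineDegree 𝓕 v), sum_const, smul_eq_mul, mul_comm]
    · congr 1
      have := card_filter_add_card_filter_not (s := 𝓕) (v ∈ ·)
      rw [lineDegree]
      omega
    · intro L hL
      rw [mem_filter] at hL
      have h1 := h.card_inter_unjoined_add hL.2 fun L' hL' hv' =>
        h.card_inter L hL.1 L' hL' (fun e => hL.2 (e ▸ hv'))
      rw [h.card_line L hL.1, inter_comm] at h1
      omega
    · intro L hL
      rw [mem_filter] at hL
      rw [card_eq_zero, eq_empty_iff_forall_notMem]
      intro w hw
      rw [mem_inter] at hw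
      exact (mem_unjoined.1 hw.1).2 L hL.1 hL.2 hw.2
  have hsplit : ∑ w ∈ U, lineDegree 𝓕 w + ∑ w ∈ X, lineDegree 𝓕 w =
      ∑ w ∈ unjoined 𝓕 v, lineDegree 𝓕 w := sum_sdiff hXK
  have hcard : #U + #X = #(unjoined 𝓕 v) := card_sdiff_add_card_eq_card hXK
  have hK := h.card_unjoined_add v
  have hle := h.lineDegree_le v
  have hlt := h.lt
  have hf := h.card_lines
  obtain ⟨φ, hφ⟩ : ∃ φ, lineDegree 𝓕 v + φ = q + 1 := ⟨_, Nat.add_sub_of_le hle⟩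
  -- Since m < q and `lineDegree 𝓕 v` ≤ q + 1, more than q(q-1) lines avoid v. This is where the
  -- bound on m enters.
  have hf2 : ∃ r, #𝓕 = lineDegree 𝓕 v + q * (q - 1) + 1 + r := by
    refine ⟨#𝓕 - (lineDegree 𝓕 v + q * (q - 1) + 1), ?_⟩
    have : q * (q - 1) + q = q ^ 2 := by
      obtain ⟨k, rfl⟩ : ∃ k, q = k + 1 := ⟨q - 1, by omega⟩
      simp; ring
    omega
  obtain ⟨r, hr⟩ := hf2
  have hφ1 : q + 1 - lineDegree 𝓕 v = φ := by omega
  have hr1 : #𝓕 - lineDegree 𝓕 v = q * (q - 1) + 1 + r := by omega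
  rw [hφ1, hr1] at hKs
  have hUcard : #U + #𝒞 * q = φ * q := by
    have : q * φ + q * lineDegree 𝓕 v = q * (q + 1) := by rw [← hφ]; ring
    linarith
  have hXs' : ∑ w ∈ X, lineDegree 𝓕 w = #𝒞 * (q * (q - 1) + 1 + r) := by
    rw [hr] at hXs
    linarith
  have hg : φ ≤ #𝒞 := by
    by_contra hc
    push Not at hc
    obtain ⟨d, rfl⟩ : ∃ d, φ = #𝒞 + 1 + d := ⟨φ - (#𝒞 + 1), by omega⟩
    have hUd : #U = (1 + d) * q := by linarith
    rw [hUd] at hUs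
    have h9 : (1 + d) * (q * (q - 1) + 1 + r) ≤ (1 + d) * q * (q - 1) := by linarith
    have h10 : (1 + d) * (q * (q - 1)) < (1 + d) * (q * (q - 1) + 1 + r) :=
      Nat.mul_lt_mul_of_pos_left (by omega) (by omega)
    rw [← mul_assoc] at h10
    omega
  have hU0 : #U = 0 := by
    have := Nat.mul_le_mul_right q hg
    omega
  have hgφ : #𝒞 = φ := by
    rw [hU0, zero_add] at hUcard
    exact Nat.eq_of_mul_eq_mul_right (by omega) hUcard
  refine ⟨by omega, fun w hw => ?_⟩
  have hwX : w ∈ X := by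
    by_contra hc
    have : w ∈ U := mem_sdiff.2 ⟨hw, hc⟩
    rw [card_eq_zero] at hU0
    rw [hU0] at this
    simp at this
  simp only [hX, mem_biUnion, mem_erase, mem𝒞] at hwX
  obtain ⟨C, ⟨hC, hv⟩, -, hw⟩ := hwX
  exact ⟨C, hC, hv, hw⟩

theorem card_newLines (h : IsPartialPlane 𝓕 q m) : #(newLines 𝓕 q) = m := by
  have h1 : ∑ v, #{C ∈ newLines 𝓕 q | v ∈ C} = #(newLines 𝓕 q) * (q + 1) := by
    have := sum_lineDegree (newLines 𝓕 q) univ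
    simp only [lineDegree, univ_inter] at this
    rw [this, sum_congr rfl fun C hC => h.card_newLine hC, sum_const, smul_eq_mul]
  have h2 : ∑ v, lineDegree 𝓕 v = #𝓕 * (q + 1) := by
    rw [sum_lineDegree]
    simp only [univ_inter]
    rw [sum_congr rfl fun C hC => h.card_line C hC, sum_const, smul_eq_mul]
  have h3 : ∑ v : V, (#{C ∈ newLines 𝓕 q | v ∈ C} + lineDegree 𝓕 v) =
      (q ^ 2 + q + 1) * (q + 1) := by
    rw [sum_congr rfl fun v _ => (h.newLines_cover v).1, sum_const, card_univ, h.card_points,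
      smul_eq_mul]
  rw [sum_add_distrib, h1, h2, ← add_mul] at h3
  have h4 := Nat.eq_of_mul_eq_mul_right (by omega) h3
  have := h.card_lines
  omega

/-- A set of more than `m` pairwise unjoined points is contained in one of the new lines. -/
theorem exists_newLine_superset (h : IsPartialPlane 𝓕 q m) {X : Finset V}
    (hX : ∀ v ∈ X, ∀ w ∈ X, w ≠ v → w ∈ unjoined 𝓕 v) (hcard : m < #X) (hX2 : 2 ≤ #X) :
    ∃ C ∈ newLines 𝓕 q, X ⊆ C := by
  by_contra hc
  push Not at hc
  have hex : ∀ v w : X, v ≠ w → ∃ C : newLines 𝓕 q, (v : V) ∈ C.1 ∧ (w : V) ∈ C.1 := by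
    intro v w hne
    obtain ⟨C, hC, h1, h2⟩ := (h.newLines_cover v).2 w
      (hX v v.2 w w.2 fun e => hne (Subtype.ext e).symm)
    exact ⟨⟨C, hC⟩, h1, h2⟩
  have heq : ∀ {p₁ p₂ : X} {l₁ l₂ : newLines 𝓕 q}, (p₁ : V) ∈ l₁.1 → (p₂ : V) ∈ l₁.1 →
      (p₁ : V) ∈ l₂.1 → (p₂ : V) ∈ l₂.1 → p₁ = p₂ ∨ l₁ = l₂ := by
    intro p₁ p₂ l₁ l₂ h1 h2 h3 h4
    by_contra hn
    push Not at hn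
    exact hn.1 (Subtype.ext (card_le_one.1 (h.card_newLine_inter_newLine_le l₁.2 l₂.2
      fun e => hn.2 (Subtype.ext e)) _ (mem_inter.2 ⟨h1, h3⟩) _ (mem_inter.2 ⟨h2, h4⟩)))
  have hpt : ∀ l : newLines 𝓕 q, ∃ p : X, (p : V) ∉ l.1 := by
    intro l
    obtain ⟨x, hx, hxl⟩ := not_subset.1 (hc l.1 l.2)
    exact ⟨⟨x, hx⟩, hxl⟩
  -- De Bruijn–Erdős: if no new line contains X, the points of X and the new lines form a linear
  -- space, which has at least as many lines as points. But there are only m new lines.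
  let : Membership X (newLines 𝓕 q) := ⟨fun l p => (p : V) ∈ l.1⟩
  choose mk hmk using hex
  let : Configuration.HasLines X (newLines 𝓕 q) :=
    { exists_point := hpt
      exists_line := by
        intro p
        obtain ⟨p', hp', hne⟩ := exists_mem_ne (show 1 < #X by omega) p.1
        have hne' : (⟨p', hp'⟩ : X) ≠ p := fun e => hne (congrArg Subtype.val e)
        obtain ⟨x, hx⟩ := hpt (mk p ⟨p', hp'⟩ hne'.symm)
        have h1 := hmk p ⟨p', hp'⟩ hne'.symm
        have hxp : (⟨p', hp'⟩ : X) ≠ x := by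
          rintro rfl
          exact hx h1.2
        have h2 := hmk ⟨p', hp'⟩ x hxp
        refine ⟨mk ⟨p', hp'⟩ x hxp, fun hp => ?_⟩
        rcases heq hp h2.1 h1.1 h1.2 with e | e
        · exact hne' e.symm
        · exact hx (e ▸ h2.2)
      eq_or_eq := heq
      mkLine := fun {p₁ p₂} hne => mk p₁ p₂ hne
      mkLine_ax := fun {p₁ p₂} hne => hmk p₁ p₂ hne }
  have := Configuration.HasLines.card_le X (newLines 𝓕 q)
  rw [Fintype.card_coe, Fintype.card_coe, h.card_newLines] at this
  omega

end IsPartialPlane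
end
-- Edge-maximal graphs and the upper bound
theorem SimpleGraph.QuadFree.sup_edge {V : Type*} {G : SimpleGraph V} (h : G.QuadFree) {s p : V}
    (hpath : ∀ u y, G.Adj s u → G.Adj u y → ¬ G.Adj y p) : (G ⊔ SimpleGraph.edge s p).QuadFree := by
  intro a b c d hab h1 h2 h3 h4
  by_contra hcd
  have hh := @h a b c d hab
  simp only [SimpleGraph.sup_adj, SimpleGraph.edge_adj] at h1 h2 h3 h4
  have hc := G.adj_comm
  have hi : ∀ v, ¬ G.Adj v v := fun v => G.irrefl
  grind

theorem even_card_of_involution {α : Type*} (s : Finset α) (f : α → α) (h1 : ∀ a ∈ s, f a ∈ s)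
    (h2 : ∀ a ∈ s, f a ≠ a) (h3 : ∀ a ∈ s, f (f a) = a) : Even #s := by
  have : (∑ _a ∈ s, (1 : ZMod 2)) = 0 :=
    sum_involution (fun a _ => f a) (fun _ _ => by decide) (fun a ha _ => h2 a ha) h1 h3
  rw [sum_const, nsmul_eq_mul, mul_one, ZMod.natCast_eq_zero_iff] at this
  exact even_iff_two_dvd.2 this

section
variable {V : Type*} [Fintype V] [DecidableEq V] {G : SimpleGraph V} [DecidableRel G.Adj]
/-- The friendship theorem for `q ≥ 2`, in the version for regular graphs. -/
theorem SimpleGraph.not_forall_existsUnique_common_neighbor {q : ℕ} (hq : 2 ≤ q)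
    (hV : Fintype.card V = q ^ 2 + q + 1) (hd : ∀ v, G.degree v = q + 1) (hG : G.QuadFree)
    (hex : ∀ x y, y ≠ x → ∃ u, G.Adj x u ∧ G.Adj y u) : False := by
  -- Modulo a prime p dividing q, the degree q + 1 is 1, so A² = J and AJ = J, hence Aᵖ = J. But the
  -- trace of Aᵖ is (tr A)ᵖ = 0, whereas that of J is q² + q + 1 = 1.
  obtain ⟨p, hp, k, rfl⟩ := Nat.exists_prime_and_dvd (n := q) (by omega)
  have : Fact p.Prime := ⟨hp⟩
  set A := G.adjMatrix (ZMod p) with hA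
  set J : Matrix V V (ZMod p) := Matrix.of fun _ _ => 1 with hJ
  have hAA : A * A = J := by
    ext x y
    rw [hA, adjMatrix_mul_apply, hJ, Matrix.of_apply]
    simp only [adjMatrix_apply]
    rw [sum_boole]
    by_cases hxy : y = x
    · subst hxy
      rw [filter_true_of_mem fun u hu => by simpa [adj_comm] using hu,
        card_neighborFinset_eq_degree, hd]
      simp
    · obtain ⟨u, h1, h2⟩ := hex x y hxy
      rw [card_eq_one.2 ⟨u, ?_⟩, Nat.cast_one]
      ext w
      simp only [mem_filter, mem_neighborFinset, mem_singleton]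
      exact ⟨fun hw => hG hxy hw.2.symm hw.1 h2 h1, fun hw => hw ▸ ⟨h1, h2.symm⟩⟩
  have hAJ : A * J = J := by
    ext x y
    rw [hA, adjMatrix_mul_apply]
    simp [hJ, hd]
  have hpow : ∀ j, A ^ (j + 2) = J := by
    intro j
    induction j with
    | zero => rw [zero_add, pow_two, hAA]
    | succ j ih => rw [show j + 1 + 2 = (j + 2) + 1 by ring, pow_succ', ih, hAJ]
  have h1 := ZMod.trace_pow_card A
  obtain ⟨j, hj⟩ : ∃ j, p = j + 2 := ⟨p - 2, by have := hp.two_le; omega⟩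
  have h2 : A ^ p = J := by rw [← hpow j]; congr 1
  rw [h2, hA, trace_adjMatrix, zero_pow hp.ne_zero] at h1
  simp [hJ, Matrix.trace, hV] at h1

namespace SimpleGraph.IsNearRegular
variable {q : ℕ} {ε : V → ℕ}

variable (G) in
/-- The neighbourhoods of the vertices without defect. -/
def _root_.SimpleGraph.fullLines (ε : V → ℕ) : Finset (Finset V) :=
  ({v | ε v = 0} : Finset V).image fun v => G.neighborFinset v

theorem isPartialPlane (h : G.IsNearRegular q ε) :
    IsPartialPlane (G.fullLines ε) q #{v | ε v ≠ 0} where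
  card_points := h.card_eq
  card_lines := by
    rw [fullLines, card_image_of_injOn, card_filter_add_card_filter_not, card_univ, h.card_eq]
    intro y hy y' hy' e
    by_contra hne
    have h1 := h.quadFree.card_inter_neighborFinset_le hne
    have h2 := h.degree_add y
    have h3 := h.sum_lt
    simp only [mem_coe, mem_filter, mem_univ, true_and] at hy
    change G.neighborFinset y = G.neighborFinset y' at e
    rw [← e, inter_self, card_neighborFinset_eq_degree] at h1
    omega
  lt := by have := h.card_defect_le; omega
  card_line := by
    intro L hL
    simp only [fullLines, mem_image, mem_filter, mem_univ, true_and] at hL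
    obtain ⟨y, hy, rfl⟩ := hL
    have := h.degree_add y
    rw [card_neighborFinset_eq_degree]
    omega
  card_inter := by
    intro L hL L' hL' hne
    simp only [fullLines, mem_image, mem_filter, mem_univ, true_and] at hL hL'
    obtain ⟨y, hy, rfl⟩ := hL
    obtain ⟨y', hy', rfl⟩ := hL'
    have hyy : y' ≠ y := by rintro rfl; exact hne rfl
    obtain ⟨u, h1, h2⟩ := h.exists_common_neighbor hyy hy hy'
    refine le_antisymm (h.quadFree.card_inter_neighborFinset_le hyy.symm) (card_pos.2 ⟨u, ?_⟩)
    simpa using ⟨h1, h2⟩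

/-- This makes d(s) exceed the number of missing lines, as `exists_newLine_superset` requires. -/
theorem add_card_defect_le (h : G.IsNearRegular q ε) {s : V} (hs : ε s ≠ 0) :
    ε s + #{v | ε v ≠ 0} ≤ q := by
  have h1 : #{v | ε v ≠ 0} = #(({v | ε v ≠ 0} : Finset V).erase s) + 1 :=
    (card_erase_add_one (by simpa using hs)).symm
  have h2 : #(({v | ε v ≠ 0} : Finset V).erase s) ≤ ∑ v ∈ univ.erase s, ε v := by
    rw [card_eq_sum_ones]
    refine (sum_le_sum fun v hv => ?_).trans
      (sum_le_sum_of_subset (erase_subset_erase s (filter_subset _ _)))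
    simp only [mem_erase, mem_filter, mem_univ, true_and] at hv
    omega
  have h3 := add_sum_erase univ ε (mem_univ s)
  have h4 := h.sum_lt
  omega

/-- Two neighbours of s have s as their only common neighbour, and s is defective, so no full line
joins them. -/
theorem exists_newLine (h : G.IsNearRegular q ε) {s : V} (hs : ε s ≠ 0) :
    ∃ C ∈ newLines (G.fullLines ε) q, G.neighborFinset s ⊆ C := by
  have h1 := h.add_card_defect_le hs
  have h2 := h.degree_add s
  have h3 : 0 < #{v | ε v ≠ 0} := card_pos.2 ⟨s, by simpa using hs⟩
  refine h.isPartialPlane.exists_newLine_superset ?_ ?_ ?_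
  · intro v hv w hw hne
    rw [mem_unjoined]
    refine ⟨hne, fun L hL hvL hwL => ?_⟩
    simp only [fullLines, mem_image, mem_filter, mem_univ, true_and] at hL
    obtain ⟨y, hy, rfl⟩ := hL
    rw [mem_neighborFinset] at hv hw hvL hwL
    have := h.quadFree hne hw.symm hv.symm hwL.symm hvL.symm
    exact hs (this ▸ hy)
  · rw [card_neighborFinset_eq_degree]; omega
  · rw [card_neighborFinset_eq_degree]; omega

/-- Inside q + 1 points, two neighbourhoods sharing at most one point would give d(s) + d(t) ≤ q +
2, but the total defect allows no less than q + 3. -/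
theorem newLine_injective (h : G.IsNearRegular q ε) {s t : V}
    {C : Finset V} (hC : C ∈ newLines (G.fullLines ε) q) (hsC : G.neighborFinset s ⊆ C)
    (htC : G.neighborFinset t ⊆ C) : s = t := by
  by_contra hne
  have h1 := h.quadFree.card_inter_neighborFinset_le hne
  have h2 := card_union_add_card_inter (G.neighborFinset s) (G.neighborFinset t)
  have h3 := card_le_card (union_subset hsC htC)
  rw [h.isPartialPlane.card_newLine hC] at h3
  have h4 := h.degree_add s
  have h5 := h.degree_add t
  have h6 : ε s + ε t ≤ ∑ v, ε v := by
    rw [← add_sum_erase univ ε (mem_univ s)]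
    gcongr
    exact single_le_sum (f := ε) (fun _ _ => Nat.zero_le _) (mem_erase.2 ⟨Ne.symm hne, mem_univ t⟩)
  have h7 := h.sum_lt
  rw [card_neighborFinset_eq_degree, card_neighborFinset_eq_degree] at h2
  omega

/-- If no edge can be added, a vertex with a defect is the absolute point of a new line. -/
theorem insert_neighborFinset_mem (h : G.IsNearRegular q ε)
    (hmax : ∀ s p, s ≠ p → ¬ G.Adj s p → ¬ (G ⊔ SimpleGraph.edge s p).QuadFree) {s : V}
    (hs : ε s ≠ 0) : insert s (G.neighborFinset s) ∈ newLines (G.fullLines ε) q := by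
  obtain ⟨C, hC, hsC⟩ := h.exists_newLine hs
  have hP := h.isPartialPlane
  have hsub : ∀ p ∈ C, p = s ∨ G.Adj s p := by
    intro p hp
    by_contra hc
    push Not at hc
    -- A point p of C that is neither s nor a neighbour of s could be joined to s. A path s, u, y, p
    -- would put u and p both in C and in N(y), which is a line or lies in another new line, and
    -- these meet C at most once.
    refine hmax s p (Ne.symm hc.1) hc.2 (h.quadFree.sup_edge fun u y h1 h2 h3 => ?_)
    have huC : u ∈ C := hsC (by simpa using h1)
    have hup : u ≠ p := fun e => hc.2 (e ▸ h1)
    have hys : y ≠ s := fun e => hc.2 (e ▸ h3)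
    by_cases hy : ε y = 0
    · have hL : G.neighborFinset y ∈ G.fullLines ε := mem_image_of_mem _ (by simpa using hy)
      exact hup (card_le_one.1 (hP.card_newLine_inter hC hL).le u
        (mem_inter.2 ⟨huC, by simpa using h2.symm⟩) p (mem_inter.2 ⟨hp, by simpa using h3⟩))
    · obtain ⟨C', hC', hyC⟩ := h.exists_newLine hy
      have hne : C ≠ C' := by
        rintro rfl
        exact hys (h.newLine_injective hC hyC hsC)
      exact hup (card_le_one.1 (hP.card_newLine_inter_newLine_le hC hC' hne) u
        (mem_inter.2 ⟨huC, hyC (by simpa using h2.symm)⟩) p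
        (mem_inter.2 ⟨hp, hyC (by simpa using h3)⟩))
  have : C = insert s (G.neighborFinset s) := by
    refine eq_of_subset_of_card_le (fun p hp => ?_) ?_
    · simpa using hsub p hp
    · rw [hP.card_newLine hC, card_insert_of_notMem (by simp), card_neighborFinset_eq_degree]
      have := h.degree_add s
      omega
  exact this ▸ hC

theorem eq_zero_of_adj (h : G.IsNearRegular q ε)
    (hmax : ∀ s p, s ≠ p → ¬ G.Adj s p → ¬ (G ⊔ SimpleGraph.edge s p).QuadFree) {s y : V}
    (hs : ε s ≠ 0) (hsy : G.Adj s y) : ε y = 0 := by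
  by_contra hy
  have hCs := h.insert_neighborFinset_mem hmax hs
  have hCy := h.insert_neighborFinset_mem hmax hy
  have hne : insert s (G.neighborFinset s) ≠ insert y (G.neighborFinset y) := by
    intro e
    refine hsy.ne (h.newLine_injective hCs (subset_insert _ _) ?_)
    rw [e]
    exact subset_insert _ _
  refine hsy.ne (card_le_one.1 (h.isPartialPlane.card_newLine_inter_newLine_le hCs hCy hne) s ?_ y ?_)
  · simp [hsy.symm]
  · simp [hsy]

/-- Sending x to the common neighbour of x and y is an involution without fixed points. Its values
are non-defective: for defective w the new line N(w) ∪ {w} would meet the line N(x) in both y and w.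
-/
theorem even_card_zero (h : G.IsNearRegular q ε)
    (hmax : ∀ s p, s ≠ p → ¬ G.Adj s p → ¬ (G ⊔ SimpleGraph.edge s p).QuadFree) {y : V}
    (hy : ε y = 0) : Even #{x ∈ G.neighborFinset y | ε x = 0} := by
  have hex : ∀ x ∈ ({x ∈ G.neighborFinset y | ε x = 0} : Finset V), ∃ w, G.Adj y w ∧ G.Adj x w := by
    intro x hx
    rw [mem_filter, mem_neighborFinset] at hx
    exact h.exists_common_neighbor hx.1.ne' hy hx.2
  choose! f hf using hex
  have hmem : ∀ x ∈ ({x ∈ G.neighborFinset y | ε x = 0} : Finset V),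
      f x ∈ ({x ∈ G.neighborFinset y | ε x = 0} : Finset V) := by
    intro x hx
    have h1 := hf x hx
    rw [mem_filter, mem_neighborFinset] at hx ⊢
    refine ⟨h1.1, ?_⟩
    by_contra hw
    have hC := h.insert_neighborFinset_mem hmax hw
    have hL : G.neighborFinset x ∈ G.fullLines ε := mem_image_of_mem _ (by simpa using hx.2)
    refine h1.1.ne (card_le_one.1 (h.isPartialPlane.card_newLine_inter hC hL).le y ?_ (f x) ?_)
    · simpa using ⟨Or.inr h1.1.symm, hx.1.symm⟩
    · simpa using h1.2
  refine even_card_of_involution _ f hmem (fun x hx e => ?_) fun x hx => ?_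
  · have h1 := (hf x hx).2
    rw [e] at h1
    exact G.irrefl h1
  · have h1 := hf x hx
    have h2 := hf _ (hmem x hx)
    rw [mem_filter, mem_neighborFinset] at hx
    exact h.quadFree h1.1.ne h2.1 h2.2 hx.1 h1.2.symm

theorem false_of_maximal (h : G.IsNearRegular q ε) (hq : 2 ≤ q)
    (hmax : ∀ s p, s ≠ p → ¬ G.Adj s p → ¬ (G ⊔ SimpleGraph.edge s p).QuadFree) : False := by
  by_cases hS : ∀ v, ε v = 0
  · exact SimpleGraph.not_forall_existsUnique_common_neighbor hq h.card_eq
      (fun v => by simpa [hS v] using h.degree_add v) h.quadFree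
      fun x y hxy => h.exists_common_neighbor hxy (hS x) (hS y)
  push Not at hS
  obtain ⟨s, hs⟩ := hS
  have hm := h.card_defect_le
  have hsplit : ∀ y, ε y = 0 → ∃ k, k + k + #{x ∈ G.neighborFinset y | ε x ≠ 0} = q + 1 := by
    intro y hy
    obtain ⟨k, hk⟩ := h.even_card_zero hmax hy
    have h1 : #{x ∈ G.neighborFinset y | ε x = 0} + #{x ∈ G.neighborFinset y | ε x ≠ 0} =
        #(G.neighborFinset y) := card_filter_add_card_filter_not _
    have h2 := h.degree_add y
    rw [card_neighborFinset_eq_degree] at h1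
    exact ⟨k, by omega⟩
  rcases Nat.even_or_odd q with ⟨r, hr⟩ | ⟨r, hr⟩
  -- For q even, q + 1 is odd, so every non-defective vertex has a defective neighbour. Then at most
  -- q - 1 closed neighbourhoods of size at most q + 1 would cover all the vertices.
  · have hcov : (univ : Finset V) ⊆ ({v | ε v ≠ 0} : Finset V).biUnion
        fun s => insert s (G.neighborFinset s) := by
      intro y _
      rw [mem_biUnion]
      by_cases hy : ε y = 0
      · obtain ⟨k, hk⟩ := hsplit y hy
        have h1 : 0 < #{x ∈ G.neighborFinset y | ε x ≠ 0} := by omega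
        obtain ⟨x, hx⟩ := card_pos.1 h1
        rw [mem_filter, mem_neighborFinset] at hx
        exact ⟨x, by simpa using hx.2, by simpa using Or.inr hx.1.symm⟩
      · exact ⟨y, by simpa using hy, mem_insert_self _ _⟩
    have h1 := (card_le_card hcov).trans (card_biUnion_le_card_mul _ _ (q + 1) fun v hv => ?_)
    · rw [card_univ, h.card_eq] at h1
      nlinarith
    · rw [card_insert_of_notMem (by simp), card_neighborFinset_eq_degree]
      have := h.degree_add v
      have : ε v ≠ 0 := by simpa using hv
      omega
  -- For q odd, every neighbour of s has an even number of defective neighbours, so one besides s.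
  -- Distinct neighbours of s give distinct ones, so the q neighbours of s inject into S \ {s}.
  · have hex : ∀ y ∈ G.neighborFinset s, ∃ t, t ≠ s ∧ G.Adj y t ∧ ε t ≠ 0 := by
      intro y hy
      rw [mem_neighborFinset] at hy
      obtain ⟨k, hk⟩ := hsplit y (h.eq_zero_of_adj hmax hs hy)
      have hsm : s ∈ ({x ∈ G.neighborFinset y | ε x ≠ 0} : Finset V) := by
        simpa using ⟨hy.symm, hs⟩
      have h1 : 0 < #{x ∈ G.neighborFinset y | ε x ≠ 0} := card_pos.2 ⟨s, hsm⟩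
      obtain ⟨t, ht, hts⟩ := exists_mem_ne
        (show 1 < #{x ∈ G.neighborFinset y | ε x ≠ 0} by omega) s
      rw [mem_filter, mem_neighborFinset] at ht
      exact ⟨t, hts, ht⟩
    choose! g hg using hex
    have h1 : #(G.neighborFinset s) ≤ #(({v | ε v ≠ 0} : Finset V).erase s) := by
      refine card_le_card_of_injOn g (fun y hy => ?_) fun y hy y' hy' e => ?_
      · have := hg y hy
        simpa using ⟨this.2.2, this.1⟩
      · have h1 := hg y hy
        have h2 := hg y' hy'
        rw [mem_coe, mem_neighborFinset] at hy hy'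
        exact h.quadFree h1.1.symm hy h1.2.1.symm hy' (e ▸ h2.2.1.symm)
    rw [card_erase_of_mem (by simpa using hs), card_neighborFinset_eq_degree] at h1
    have h2 := h.degree_add s
    have h3 := h.insert_neighborFinset_mem hmax hs
    have h4 := h.isPartialPlane.card_newLine h3
    rw [card_insert_of_notMem (by simp), card_neighborFinset_eq_degree] at h4
    omega

end SimpleGraph.IsNearRegular

theorem SimpleGraph.QuadFree.two_mul_card_edgeFinset_le {q : ℕ} (hq : 2 ≤ q)
    (hV : Fintype.card V = q ^ 2 + q + 1) (hG : G.QuadFree)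
    (hmax : ∀ s p, s ≠ p → ¬ G.Adj s p → ¬ (G ⊔ SimpleGraph.edge s p).QuadFree) :
    2 * #G.edgeFinset ≤ q * (q + 1) ^ 2 := by
  by_contra hc
  push Not at hc
  have hs := G.sum_degrees_eq_twice_card_edges
  -- Twice the number of edges exceeds an even number, hence exceeds it by at least 2. This is what
  -- keeps the total defect below q.
  have hev : Even (q * (q + 1) ^ 2) := by
    rw [pow_two, ← mul_assoc]
    exact (Nat.even_mul_succ_self q).mul_right _
  obtain ⟨r, hr⟩ := hev
  have hdeg := hG.degree_le hq hV (by omega)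
  have hε : ∀ v, G.degree v + (q + 1 - G.degree v) = q + 1 := fun v => by
    have := hdeg v; omega
  refine SimpleGraph.IsNearRegular.false_of_maximal (q := q) (ε := fun v => q + 1 - G.degree v)
    ⟨hG, hε, hV, ?_⟩ hq hmax
  have h1 : ∑ v, (G.degree v + (q + 1 - G.degree v)) = (q ^ 2 + q + 1) * (q + 1) := by
    rw [sum_congr rfl fun v _ => hε v, sum_const, card_univ, hV, smul_eq_mul]
  rw [sum_add_distrib] at h1
  have h2 : (q ^ 2 + q + 1) * (q + 1) = q * (q + 1) ^ 2 + q + 1 := by ring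
  omega

end

theorem two_mul_extremalNumber_cycleGraph_four_le {q : ℕ} (hq : 2 ≤ q) :
    2 * SimpleGraph.extremalNumber (q ^ 2 + q + 1) (SimpleGraph.cycleGraph 4) ≤
      q * (q + 1) ^ 2 := by
  classical
  have hne : SimpleGraph.cycleGraph 4 ≠ ⊥ := by
    intro e
    have : (SimpleGraph.cycleGraph 4).Adj 0 1 := by decide
    rw [e] at this
    exact this
  obtain ⟨G, _, hG⟩ := SimpleGraph.exists_isExtremal_free (V := Fin (q ^ 2 + q + 1)) hne
  have h1 := SimpleGraph.card_edgeFinset_of_isExtremal_free hG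
  rw [Fintype.card_fin] at h1
  rw [← h1]
  refine SimpleGraph.QuadFree.two_mul_card_edgeFinset_le hq (Fintype.card_fin _)
    ((SimpleGraph.cycleGraph_four_free_iff G).1 hG.prop) fun s p hsp hadj hQ => ?_
  have h2 := hG.2 ((SimpleGraph.cycleGraph_four_free_iff _).2 hQ)
  have h3 : #G.edgeFinset + 1 ≤ #G.edgeFinset := by
    refine le_of_eq_of_le ?_ h2
    rw [← SimpleGraph.card_edgeFinset_sup_edge G hadj hsp]
    congr!
  omega

/-! ### Sum graphs of Sidon sets -/

/-- A finset all of whose coincidences `a + b = c + d` are trivial. -/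
def Finset.IsSidon {X : Type*} [AddCommGroup X] (A : Finset X) : Prop :=
  ∀ ⦃a⦄, a ∈ A → ∀ ⦃b⦄, b ∈ A → ∀ ⦃c⦄, c ∈ A → ∀ ⦃d⦄, d ∈ A → a + b = c + d → a = c ∨ a = d

theorem sumGraph_adj {X : Type*} [AddCommGroup X] {A : Set X} {x y : X} :
    (sumGraph A).Adj x y ↔ x ≠ y ∧ x + y ∈ A :=
  Iff.rfl

theorem sumGraph_quadFree {X : Type*} [AddCommGroup X] {A : Finset X} (hA : A.IsSidon) :
    (sumGraph (A : Set X)).QuadFree := by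
  intro a b c d hab h1 h2 h3 h4
  rcases hA h1.2 h4.2 h2.2 h3.2 (by abel) with e | e
  · exact absurd (add_right_cancel e) hab
  · exact add_left_cancel e

/-- A vertex v has degree #A, less one when v + v ∈ A because of the excluded loop. As doubling is
bijective, this happens for exactly #A vertices. -/
theorem two_mul_ncard_edgeSet_sumGraph {X : Type*} [AddCommGroup X] [Fintype X] (A : Finset X)
    (hX : Function.Injective fun x : X => x + x) :
    2 * (sumGraph (A : Set X)).edgeSet.ncard + #A = Fintype.card X * #A := by
  classical
  have h1 := (sumGraph (A : Set X)).sum_degrees_eq_twice_card_edges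
  rw [Set.ncard_eq_toFinset_card', ← SimpleGraph.edgeFinset, ← h1]
  have h2 : #A = ∑ v : X, if v + v ∈ A then 1 else 0 := by
    rw [← card_filter, ← card_image_of_injective (univ.filter fun v => v + v ∈ A) hX]
    congr 1
    ext a
    simp only [mem_image, mem_filter, mem_univ, true_and]
    constructor
    · intro ha
      obtain ⟨v, rfl⟩ := Finite.surjective_of_injective hX a
      exact ⟨v, ha, rfl⟩
    · rintro ⟨v, hv, rfl⟩
      exact hv
  have h3 : ∀ v : X, (sumGraph (A : Set X)).degree v + (if v + v ∈ A then 1 else 0) = #A := by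
    intro v
    rw [← SimpleGraph.card_neighborFinset_eq_degree]
    have h4 : #A = #(univ.filter fun w => v + w ∈ A) := by
      rw [← card_map (addLeftEmbedding (-v))]
      congr 1
      ext w
      simp only [mem_map, addLeftEmbedding_apply, mem_filter, mem_univ, true_and]
      exact ⟨by rintro ⟨a, ha, rfl⟩; simpa using ha, fun h => ⟨v + w, h, by simp⟩⟩
    rw [h4]
    split_ifs with hv
    · rw [← card_erase_add_one (s := univ.filter fun w => v + w ∈ A) (a := v) (by simpa using hv)]
      congr 2
      ext w
      simp [sumGraph_adj, eq_comm]
    · rw [add_zero]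
      congr 1
      ext w
      simp only [SimpleGraph.mem_neighborFinset, sumGraph_adj, mem_coe, mem_filter, mem_univ, true_and,
        and_iff_right_iff_imp]
      rintro h rfl
      exact hv h
  conv_lhs => rw [h2]
  rw [← sum_add_distrib, sum_congr rfl fun v _ => h3 v, sum_const, card_univ, smul_eq_mul]

theorem ZMod.add_self_injective {n : ℕ} (hn : Odd n) :
    Function.Injective fun x : ZMod n => x + x := by
  intro x y hxy
  have h2 : IsUnit ((2 : ℕ) : ZMod n) := (ZMod.isUnit_iff_coprime 2 n).2 (Nat.coprime_two_left.2 hn)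
  refine h2.mul_left_cancel ?_
  simpa [two_mul] using hxy

/-! ### Singer sets -/

section
open Polynomial
variable {F K : Type*} [Field F] [Field K] [Algebra F K] {θ : Kˣ} {q : ℕ}

theorem adjoin_generator_eq_top (hθ : ∀ x : Kˣ, x ∈ Subgroup.zpowers θ) :
    IntermediateField.adjoin F {(θ : K)} = ⊤ := by
  rw [eq_top_iff]
  intro x _
  by_cases hx : x = 0
  · rw [hx]; exact zero_mem _
  · obtain ⟨k, hk⟩ := hθ (Units.mk0 x hx)
    have : x = (θ : K) ^ k := by
      have := congrArg Units.val hk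
      simpa using this.symm
    rw [this]
    exact zpow_mem (IntermediateField.mem_adjoin_simple_self F _) k

theorem eq_zero_of_aeval_generator [FiniteDimensional F K]
    (hθ : ∀ x : Kˣ, x ∈ Subgroup.zpowers θ) {P : F[X]} (hP : aeval (θ : K) P = 0)
    (hdeg : P.natDegree < Module.finrank F K) : P = 0 := by
  by_contra h0
  rw [← (Field.primitive_element_iff_minpoly_natDegree_eq F (θ : K)).1
    (adjoin_generator_eq_top hθ)] at hdeg
  have := natDegree_le_natDegree (minpoly.degree_le_of_ne_zero F (θ : K) h0 hP)
  omega

/-- The affine polynomial `X + a`, or `1` at infinity. -/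
noncomputable def affinePoly : Option F → F[X]
  | none => 1
  | some a => X + C a

theorem affinePoly_monic (o : Option F) : (affinePoly o).Monic := by
  cases o with
  | none => exact monic_one
  | some a => exact monic_X_add_C a

theorem natDegree_affinePoly_le (o : Option F) : (affinePoly o).natDegree ≤ 1 := by
  cases o with
  | none => simp [affinePoly]
  | some a => simp [affinePoly]

theorem affinePoly_injective : Function.Injective (affinePoly : Option F → F[X]) := by
  have key : ∀ a : F, (X + C a) ≠ (1 : F[X]) := fun a e => by
    have := congrArg natDegree e
    simp at this
  rintro (_ | a) (_ | b) h
  · rfl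
  · exact absurd h.symm (key b)
  · exact absurd h (key a)
  · simpa [affinePoly] using h

/-- Unique factorisation: X + a is prime, and divides a factor on the right only if it equals that
factor. If the first factor is 1, comparing degrees leaves a factor 1 on the right. -/
theorem affinePoly_mul_eq {o₁ o₂ o₃ o₄ : Option F}
    (h : affinePoly o₁ * affinePoly o₂ = affinePoly o₃ * affinePoly o₄) : o₁ = o₃ ∨ o₁ = o₄ := by
  have key : ∀ (a : F) (o : Option F), (X + C a) ∣ affinePoly o → some a = o := by
    intro a o hd
    cases o with
    | none =>
      have := natDegree_le_of_dvd hd one_ne_zero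
      simp [affinePoly] at this
    | some b =>
      have : X + C b = X + C a := eq_of_monic_of_dvd_of_natDegree_le (monic_X_add_C a)
        (monic_X_add_C b) hd (by simp)
      simpa using this.symm
  cases o₁ with
  | some a =>
    have hp : Prime (X + C a) := by
      have := prime_X_sub_C (-a)
      simpa using this
    have hd : (X + C a) ∣ affinePoly o₃ * affinePoly o₄ := h ▸ Dvd.intro _ rfl
    exact (hp.dvd_or_dvd hd).imp (key a o₃) (key a o₄)
  | none =>
    cases o₃ with
    | none => exact Or.inl rfl
    | some b =>
      cases o₄ with
      | none => exact Or.inr rfl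
      | some c =>
        exfalso
        have h1 := congrArg natDegree h
        rw [(affinePoly_monic _).natDegree_mul (affinePoly_monic _),
          (affinePoly_monic _).natDegree_mul (affinePoly_monic _)] at h1
        have := natDegree_affinePoly_le o₂
        simp [affinePoly] at h1 this
        omega

/-- θ has degree 3 over F, so the relation holds between the polynomials themselves, and comparing
leading coefficients gives c = 1. -/
theorem eq_of_aeval_generator [FiniteDimensional F K] (hK : Module.finrank F K = 3)
    (hθ : ∀ x : Kˣ, x ∈ Subgroup.zpowers θ) {P Q : F[X]} (hP : P.Monic) (hQ : Q.Monic)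
    (hPd : P.natDegree ≤ 2) (hQd : Q.natDegree ≤ 2) {c : F}
    (h : aeval (θ : K) P = algebraMap F K c * aeval (θ : K) Q) : P = Q := by
  have h0 : P - C c * Q = 0 := by
    refine eq_zero_of_aeval_generator hθ ?_ ?_
    · rw [map_sub, map_mul, aeval_C, h, sub_self]
    · rw [hK]
      refine (natDegree_sub_le _ _).trans_lt ?_
      have := natDegree_C_mul_le c Q
      omega
  have h1 : P = C c * Q := sub_eq_zero.1 h0
  have h2 := congrArg leadingCoeff h1
  rw [leadingCoeff_mul, leadingCoeff_C, hP.leadingCoeff, hQ.leadingCoeff, mul_one] at h2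
  rw [h1, ← h2, C_1, one_mul]

/-- The power of θ with exponent q² + q + 1 = (q³ - 1)/(q - 1) is the norm of θ, which lies in F. -/
theorem exists_pow_eq_of_modEq (hF : Nat.card F = q) (hq : 2 ≤ q) [Finite F] [FiniteDimensional F K]
    (hK : Module.finrank F K = 3) (θ : Kˣ) {k l : ℕ} (h : k ≡ l [MOD q ^ 2 + q + 1]) :
    ∃ c : F, (θ : K) ^ k = algebraMap F K c * (θ : K) ^ l := by
  have : Finite K := Module.finite_of_finite F
  have hN : (Nat.card K - 1) / (Nat.card F - 1) = q ^ 2 + q + 1 := by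
    rw [Module.natCard_eq_pow_finrank (K := F), hK, hF]
    obtain ⟨r, rfl⟩ : ∃ r, q = r + 2 := ⟨q - 2, by omega⟩
    refine Nat.div_eq_of_eq_mul_left (by omega) ?_
    rw [Nat.sub_eq_iff_eq_add (Nat.one_le_pow _ _ (by omega)),
      show r + 2 - 1 = r + 1 by omega]
    ring
  have hn := FiniteField.algebraMap_norm_eq_pow (K := F) (x := (θ : K))
  rw [hN] at hn
  rcases le_total l k with hle | hle
  · obtain ⟨j, hj⟩ := (Nat.modEq_iff_dvd' hle).1 h.symm
    refine ⟨Algebra.norm F (θ : K) ^ j, ?_⟩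
    rw [map_pow, hn, ← pow_mul, ← pow_add, ← hj, Nat.sub_add_cancel hle]
  · obtain ⟨j, hj⟩ := (Nat.modEq_iff_dvd' hle).1 h
    refine ⟨(Algebra.norm F (θ : K) ^ j)⁻¹, ?_⟩
    rw [map_inv₀, map_pow, hn, ← pow_mul, ← hj, eq_inv_mul_iff_mul_eq₀ (by simp), ← pow_add,
      Nat.sub_add_cancel hle]

theorem sq_add_self_add_one_dvd (hq : 1 ≤ q) : q ^ 2 + q + 1 ∣ q ^ 3 - 1 := by
  obtain ⟨r, rfl⟩ : ∃ r, q = r + 1 := ⟨q - 1, by omega⟩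
  refine ⟨r, ?_⟩
  rw [Nat.sub_eq_iff_eq_add (Nat.one_le_pow _ _ (by omega))]
  ring

theorem orderOf_generator (hF : Nat.card F = q) [Finite F] [FiniteDimensional F K]
    (hK : Module.finrank F K = 3) (hθ : ∀ x : Kˣ, x ∈ Subgroup.zpowers θ) :
    orderOf θ = q ^ 3 - 1 := by
  have : Finite K := Module.finite_of_finite F
  rw [orderOf_eq_card_of_forall_mem_zpowers hθ, Nat.card_units,
    Module.natCard_eq_pow_finrank (K := F), hK, hF]

theorem mem_singerSet_iff (hF : Nat.card F = q) (hq : 2 ≤ q) [Finite F] [FiniteDimensional F K]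
    (hK : Module.finrank F K = 3) (hθ : ∀ x : Kˣ, x ∈ Subgroup.zpowers θ)
    {g : ZMod (q ^ 2 + q + 1)} :
    g ∈ singerSet q F θ ↔
      ∃ (k : ℕ) (o : Option F), (k : ZMod (q ^ 2 + q + 1)) = g ∧
        (θ : K) ^ k = aeval (θ : K) (affinePoly o) := by
  have hord := orderOf_generator hF hK hθ
  have hdvd := sq_add_self_add_one_dvd (by omega : 1 ≤ q)
  constructor
  · rintro (⟨b, ⟨a, ha⟩, rfl⟩ | rfl)
    · exact ⟨b.val, some a, rfl, by simpa [affinePoly] using ha⟩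
    · exact ⟨0, none, by simp, by simp [affinePoly]⟩
  · rintro ⟨k, o, rfl, hk⟩
    cases o with
    | some a =>
      refine Or.inl ⟨(k : ZMod (q ^ 3 - 1)), ⟨a, ?_⟩, ?_⟩
      · rw [ZMod.val_natCast, ← hord]
        have h1 : θ ^ (k % orderOf θ) = θ ^ k := pow_mod_orderOf θ k
        rw [← Units.val_pow_eq_pow_val, h1, Units.val_pow_eq_pow_val, hk]
        simp [affinePoly]
      · change (((k : ZMod (q ^ 3 - 1)).val : ℕ) : ZMod (q ^ 2 + q + 1)) = k
        rw [ZMod.val_natCast, ZMod.natCast_eq_natCast_iff]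
        exact (Nat.mod_modEq k _).of_dvd hdvd
    | none =>
      refine Or.inr ?_
      have h1 : θ ^ k = 1 := by
        apply Units.ext
        rw [Units.val_pow_eq_pow_val, hk]
        simp [affinePoly]
      rw [Set.mem_singleton_iff, ZMod.natCast_eq_zero_iff]
      exact hdvd.trans (hord ▸ orderOf_dvd_of_pow_eq_one h1)

theorem exists_pow_eq_aeval_affinePoly [FiniteDimensional F K] (hK : Module.finrank F K = 3)
    [Finite F] (hθ : ∀ x : Kˣ, x ∈ Subgroup.zpowers θ) (o : Option F) :
    ∃ k : ℕ, (θ : K) ^ k = aeval (θ : K) (affinePoly o) := by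
  have : Finite K := Module.finite_of_finite F
  have h0 : aeval (θ : K) (affinePoly o) ≠ 0 := fun h =>
    (affinePoly_monic o).ne_zero (eq_zero_of_aeval_generator hθ h
      (by have := natDegree_affinePoly_le o; omega))
  obtain ⟨k, hk⟩ := mem_powers_iff_mem_zpowers.2 (hθ (Units.mk0 _ h0))
  refine ⟨k, ?_⟩
  have := congrArg Units.val hk
  simpa using this

theorem exists_singer_finset (hF : Nat.card F = q) (hq : 2 ≤ q)
    (hK : Module.finrank F K = 3) (hθ : ∀ x : Kˣ, x ∈ Subgroup.zpowers θ) :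
    ∃ A : Finset (ZMod (q ^ 2 + q + 1)), (A : Set _) = singerSet q F θ ∧ A.IsSidon ∧
      #A = q + 1 := by
  classical
  have : Finite F := Nat.finite_of_card_ne_zero (by omega)
  have : FiniteDimensional F K := FiniteDimensional.of_finrank_pos (by omega)
  have := Fintype.ofFinite F
  choose k hk using exists_pow_eq_aeval_affinePoly (F := F) hK hθ
  have hinj : ∀ {o o' : Option F} {i j : ℕ}, (θ : K) ^ i = aeval (θ : K) (affinePoly o) →
      (θ : K) ^ j = aeval (θ : K) (affinePoly o') →
      (i : ZMod (q ^ 2 + q + 1)) = j → o = o' := by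
    intro o o' i j hi hj h
    obtain ⟨c, hc⟩ := exists_pow_eq_of_modEq hF hq hK θ ((ZMod.natCast_eq_natCast_iff _ _ _).1 h)
    rw [hi, hj] at hc
    refine affinePoly_injective (eq_of_aeval_generator hK hθ (affinePoly_monic o)
      (affinePoly_monic o') ?_ ?_ hc)
    · have := natDegree_affinePoly_le o; omega
    · have := natDegree_affinePoly_le o'; omega
  have hmem : ∀ {i : ℕ} {o : Option F}, (θ : K) ^ i = aeval (θ : K) (affinePoly o) →
      (i : ZMod (q ^ 2 + q + 1)) = k o := by
    intro i o hi
    have h1 : θ ^ i = θ ^ k o := Units.ext (by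
      rw [Units.val_pow_eq_pow_val, Units.val_pow_eq_pow_val, hi, hk])
    have hord := orderOf_generator hF hK hθ
    have hdvd := sq_add_self_add_one_dvd (by omega : 1 ≤ q)
    rw [ZMod.natCast_eq_natCast_iff]
    rw [pow_eq_pow_iff_modEq, hord] at h1
    exact h1.of_dvd hdvd
  refine ⟨univ.image fun o => (k o : ZMod (q ^ 2 + q + 1)), ?_, ?_, ?_⟩
  · ext g
    rw [mem_singerSet_iff hF hq hK hθ]
    simp only [coe_image, coe_univ, Set.image_univ, Set.mem_range]
    constructor
    · rintro ⟨o, rfl⟩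
      exact ⟨k o, o, rfl, hk o⟩
    · rintro ⟨i, o, rfl, hi⟩
      exact ⟨o, (hmem hi).symm⟩
  · intro a ha b hb c hc d hd h
    simp only [mem_image, mem_univ, true_and] at ha hb hc hd
    obtain ⟨o₁, rfl⟩ := ha
    obtain ⟨o₂, rfl⟩ := hb
    obtain ⟨o₃, rfl⟩ := hc
    obtain ⟨o₄, rfl⟩ := hd
    -- The element 0 of the Singer set is the exponent of the constant polynomial 1, so all four
    -- summands are treated alike: a coincidence of sums becomes an equality of products up to a
    -- scalar.
    rw [← Nat.cast_add, ← Nat.cast_add, ZMod.natCast_eq_natCast_iff] at h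
    obtain ⟨c, hc⟩ := exists_pow_eq_of_modEq hF hq hK θ h
    rw [pow_add, pow_add, hk, hk, hk, hk, ← map_mul, ← map_mul] at hc
    have hd : ∀ o o' : Option F, (affinePoly o * affinePoly o').natDegree ≤ 2 := fun o o' =>
      natDegree_mul_le.trans (add_le_add (natDegree_affinePoly_le o) (natDegree_affinePoly_le o'))
    have := eq_of_aeval_generator hK hθ ((affinePoly_monic o₁).mul (affinePoly_monic o₂))
      ((affinePoly_monic o₃).mul (affinePoly_monic o₄)) (hd _ _) (hd _ _) hc
    exact (affinePoly_mul_eq this).imp (fun e => by rw [e]) fun e => by rw [e]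
  · rw [card_image_of_injective _ fun o o' h => hinj (hk o) (hk o') h, card_univ,
      Fintype.card_option, ← Nat.card_eq_fintype_card, hF]

theorem sumGraph_singerSet_spec (hF : Nat.card F = q) (hq : 2 ≤ q)
    (hK : Module.finrank F K = 3) (hθ : ∀ x : Kˣ, x ∈ Subgroup.zpowers θ) :
    (sumGraph (singerSet q F θ)).QuadFree ∧
      2 * (sumGraph (singerSet q F θ)).edgeSet.ncard = q * (q + 1) ^ 2 := by
  obtain ⟨A, hA, hS, hc⟩ := exists_singer_finset hF hq hK hθ
  rw [← hA]
  refine ⟨sumGraph_quadFree hS, ?_⟩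
  have hodd : Odd (q ^ 2 + q + 1) := by
    rw [pow_two, ← Nat.mul_succ]
    exact (Nat.even_mul_succ_self q).add_one
  have h1 := two_mul_ncard_edgeSet_sumGraph A (ZMod.add_self_injective hodd)
  rw [hc, ZMod.card] at h1
  nlinarith

end

/-! ### The extremal number -/

theorem le_two_mul_extremalNumber_cycleGraph_four {q : ℕ} (hq : IsPrimePow q) :
    q * (q + 1) ^ 2 ≤
      2 * SimpleGraph.extremalNumber (q ^ 2 + q + 1) (SimpleGraph.cycleGraph 4) := by
  classical
  have hq2 := hq.two_le
  obtain ⟨p, k, hp, hk, rfl⟩ := (isPrimePow_nat_iff q).1 hq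
  have : Fact p.Prime := ⟨hp⟩
  have hF : Nat.card (GaloisField p k) = p ^ k := GaloisField.card p k hk.ne'
  obtain ⟨θ, hθ⟩ := IsCyclic.exists_generator (α := (FiniteField.Extension (GaloisField p k) p 3)ˣ)
  obtain ⟨h1, h2⟩ := sumGraph_singerSet_spec hF hq2
    (FiniteField.finrank_extension (GaloisField p k) p 3) hθ
  rw [← h2, Set.ncard_eq_toFinset_card', ← SimpleGraph.edgeFinset]
  have h3 := SimpleGraph.card_edgeFinset_le_extremalNumber
    ((SimpleGraph.cycleGraph_four_free_iff _).2 h1)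
  rw [ZMod.card] at h3
  gcongr

theorem mainTheorem2 (q : ℕ) (hq : IsPrimePow q) (hq13 : 13 < q) :
    (SimpleGraph.extremalNumber (q ^ 2 + q + 1) (SimpleGraph.cycleGraph 4) : ℚ)
        = 1 / 2 * (q : ℚ) * ((q : ℚ) + 1) ^ 2 ∧
      ∀ (F K : Type*) [Field F] [Field K] [Algebra F K] (θ : Kˣ),
        Nat.card F = q → Module.finrank F K = 3 → (∀ x : Kˣ, x ∈ Subgroup.zpowers θ) →
          (SimpleGraph.cycleGraph 4).Free (sumGraph (singerSet q F θ)) ∧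
            ((sumGraph (singerSet q F θ)).edgeSet.ncard : ℚ)
              = 1 / 2 * (q : ℚ) * ((q : ℚ) + 1) ^ 2 := by
  have hq2 : 2 ≤ q := by omega
  have key : ∀ e : ℕ, 2 * e = q * (q + 1) ^ 2 → (e : ℚ) = 1 / 2 * (q : ℚ) * ((q : ℚ) + 1) ^ 2 := by
    intro e he
    have : 2 * (e : ℚ) = q * (q + 1) ^ 2 := by exact_mod_cast he
    linarith
  refine ⟨key _ (le_antisymm (two_mul_extremalNumber_cycleGraph_four_le hq2)
    (le_two_mul_extremalNumber_cycleGraph_four hq)), ?_⟩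
  intro F K _ _ _ θ hF hK hθ
  obtain ⟨h1, h2⟩ := sumGraph_singerSet_spec hF hq2 hK hθ
  exact ⟨(SimpleGraph.cycleGraph_four_free_iff _).2 h1, key _ h2⟩
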